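/- **Theorem 2 (Plug-in Approximation).** *Setup.* On a probability space $(\Omega,\mathscr F,\mathbb P)$ let $\mathbf A_l\in\mathbb R^{T_0}$, $\mathbf B_l\in\mathbb R^{T_0\times J}$, $\mathbf C_l\in\mathbb R^{T_0\times K}$ ($1\le l\le M$), $\mathbf x_T\in\mathbb R^J$ and $\mathbf g_T\in\mathbb R^{KM}$ be random. Let $\mathbf A$ and $\mathbf B$ stack the $\mathbf A_l$ and the $\mathbf B_l$, let $\mathbf C=\mathrm{diag}(\mathbf C_1,\dots,\mathbf C_M)$, and put $\mathbf Z=(\mathbf B,\mathbf C)$, $d=J+KM$, $\mathbf p_T=(\mathbf x_T',\mathbf g_T')'$ and $\mathscr H=\sigma(\mathbf B,\mathbf C,\mathbf x_T,\mathbf g_T)$. Let $\mathcal W\subseteq\mathbb R^J$ and $\mathcal R\subseteq\mathbb R^{KM}$ be convex, and let $\mathbf D$ be a deterministic $d\times d$ diagonal matrix with positive diagonal. Assume that the following exist: a (measurable) $\widehat{\boldsymbol\beta}$ minimizing $\|\mathbf A-\mathbf Z\boldsymbol\beta\|^2$ over $\boldsymbol\beta\in\mathcal W\times\mathcal R$,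 and an ($\mathscr H$-measurable) $\boldsymbol\beta_0$ minimizing $\mathbb E[\|\mathbf A-\mathbf Z\boldsymbol\beta\|^2\mid\mathscr H]$ over $\boldsymbol\beta\in\mathcal W\times\mathcal R$. Put $\mathbf U=\mathbf A-\mathbf Z\boldsymbol\beta_0$, $\widehat{\boldsymbol\delta}=\mathbf D(\widehat{\boldsymbol\beta}-\boldsymbol\beta_0)$, $\widehat{\mathbf Q}=\mathbf D^{-1}\mathbf Z'\mathbf Z\mathbf D^{-1}$, $\widehat{\boldsymbol\gamma}=\mathbf D^{-1}\mathbf Z'\mathbf U$, $\boldsymbol\Sigma=\mathbb V[\widehat{\boldsymbol\gamma}\mid\mathscr H]$ and $\Delta=\{\mathbf D(\boldsymbol\beta-\boldsymbol\beta_0):\boldsymbol\beta\in\mathcal W\times\mathcal R\}$. Let $\mathbf G\mid\mathscr H\sim\mathsf N(\mathbf 0,\boldsymbol\Sigma)$ and $\mathcal M_{\mathbf G}=\{\boldsymbol\delta\in\Delta:\boldsymbol\delta'\widehat{\mathbf Q}\boldsymbol\delta-2\mathbf G'\boldsymbol\delta\le 0\}$, and let $\mathfrak c^\dagger(q)$ be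 the $q$-quantile, conditional on $\mathscr H$, of $\sup\{\mathbf p_T'\mathbf D^{-1}\boldsymbol\delta:\boldsymbol\delta\in\mathcal M_{\mathbf G}\}$. Let $\widehat{\boldsymbol\Sigma}$ be a random positive semidefinite $d\times d$ matrix (the estimate of $\boldsymbol\Sigma$) and $\Delta^\star\subseteq\mathbb R^d$ a random set (the constraint set used in simulation). Let $\mathfrak c^\star(q)$ be the $q$-quantile, conditional on the data, of $\varsigma^\star_{\mathtt U}=\sup\{\mathbf p_T'\mathbf D^{-1}\boldsymbol\delta:\boldsymbol\delta\in\Delta^\star,\ \boldsymbol\delta'\widehat{\mathbf Q}\boldsymbol\delta-2\mathbf G^{\star\prime}\boldsymbol\delta\le 0\}$, where $\mathbf G^\star\sim\mathsf N(\mathbf 0,\widehat{\boldsymbol\Sigma})$ given the data. Suprema are taken in $[-\infty,\infty]$, and a $q$-quantile of $\varsigma$ is the smallest $c\in[-\infty,\infty]$ with $\mathbb P(\varsigma\le c)\ge q$. Call $\Delta^\star$ *locally equal to $\Delta$ with radius $\varepsilon$* if $\varepsilon>0$ and $\Delta^\star\cap\mathcal B(\mathbf 0,\varepsilon)=\Delta\cap\mathcal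 B(\mathbf 0,\varepsilon)$, where $\mathcal B(\mathbf 0,\varepsilon)$ is the open Euclidean ball. *Theorem.* Suppose that for finite non-negative constants $\epsilon_\gamma,\pi_\gamma,\varpi_\delta^\star,\epsilon_\delta^\star,\pi_\delta^\star,\epsilon_\Delta^\star,\pi_\Delta^\star,\epsilon_{\gamma,1}^\star,\epsilon_{\gamma,2}^\star,\pi_\gamma^\star$ with $\epsilon_{\gamma,1}^\star\le 1/4$: (i) for every $a\in(0,1)$, $\mathbb P[\mathbb P(\mathbf p_T'\mathbf D^{-1}\widehat{\boldsymbol\delta}\le\mathfrak c^\dagger(1-a)\mid\mathscr H)\ge 1-a-\epsilon_\gamma]\ge 1-\pi_\gamma$; (ii) $\mathbb P[\mathbb P(\sup\{\|\boldsymbol\delta\|:\boldsymbol\delta\in\mathcal M_{\mathbf G}\}\le\varpi_\delta^\star\mid\mathscr H)\ge 1-\epsilon_\delta^\star]\ge 1-\pi_\delta^\star$; (iii) $\mathbb P[\mathbb P(\Delta^\star\text{ is locally equal to }\Delta\text{ with radius }\varpi_\delta^\star\mid\mathscr H)\ge 1-\epsilon_\Delta^\star]\ge 1-\pi_\Delta^\star$;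 (iv) $\mathbb P[\mathbb P(\boldsymbol\Sigma\text{ is invertible and }\|\boldsymbol\Sigma^{-1/2}\widehat{\boldsymbol\Sigma}\boldsymbol\Sigma^{-1/2}-\mathbf I_d\|_{\mathtt F}\le 2\epsilon_{\gamma,1}^\star\mid\mathscr H)\ge 1-\epsilon_{\gamma,2}^\star]\ge 1-\pi_\gamma^\star$, where $\|\cdot\|_{\mathtt F}$ is the Frobenius norm. Then for every $\alpha\in(0,1)$ (for which $\mathfrak c^\star(1-\alpha)$ is a measurable function on $\Omega$) $$\mathbb P\big[\mathbb P(\mathbf p_T'\mathbf D^{-1}\widehat{\boldsymbol\delta}\le\mathfrak c^\star(1-\alpha)\mid\mathscr H)\ge 1-\alpha-\epsilon\big]\ge 1-\pi,$$ where $\epsilon=\epsilon_\gamma+\epsilon_{\gamma,1}^\star+\epsilon_{\gamma,2}^\star+\epsilon_\delta^\star+\epsilon_\Delta^\star$ and $\pi=\pi_\gamma+\pi_\gamma^\star+\pi_\delta^\star+\pi_\Delta^\star$. -/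

import Mathlib

open MeasureTheory ProbabilityTheory Matrix
open scoped ENNReal MatrixOrder

noncomputable section

/-- Index set of the coefficient vector `β = (w, r)`, with `w ∈ ℝ^J` and `r ∈ ℝ^{KM}`; it has
`d = J + K M` elements. -/
abbrev CoefIdx (J K M : ℕ) : Type := Fin J ⊕ (Fin K × Fin M)

/-- The vectors `δ ∈ ℝ^d`, with the Euclidean norm. -/
abbrev CoefSpace (J K M : ℕ) : Type := EuclideanSpace ℝ (CoefIdx J K M)

/-- The raw objects of the synthetic control framework on a sample space `Ω`, with `T₀`
pre-treatment periods, `M` features, `J` donor variables and `K` controls per feature.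
No property of these objects is part of the structure. -/
structure SCModel (Ω : Type*) (T₀ J K M : ℕ) where
  /-- `A ω l t`: feature `l` of the treated unit in period `t` -/
  A : Ω → Fin M → Fin T₀ → ℝ
  /-- `B ω l t j`: feature `l` of donor `j` in period `t` -/
  B : Ω → Fin M → Fin T₀ → Fin J → ℝ
  /-- `C ω l t k`: control `k` of feature `l` in period `t` -/
  C : Ω → Fin M → Fin T₀ → Fin K → ℝ
  /-- predictors `x_T` -/
  x : Ω → Fin J → ℝ
  /-- predictors `g_T` -/
  g : Ω → Fin K × Fin M → ℝ
  /-- feasibility set of the weights `w` -/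
  W : Set (Fin J → ℝ)
  /-- feasibility set of the coefficients `r` -/
  R : Set (Fin K × Fin M → ℝ)
  /-- diagonal of the (deterministic) scaling matrix `D` -/
  scale : CoefIdx J K M → ℝ
  /-- estimated coefficients -/
  βhat : Ω → CoefIdx J K M → ℝ
  /-- pseudo-true coefficients -/
  β₀ : Ω → CoefIdx J K M → ℝ
  /-- estimate of the conditional variance `Σ` -/
  SigmaHat : Ω → Matrix (CoefIdx J K M) (CoefIdx J K M) ℝ
  /-- constraint set used in the simulation -/
  DeltaStar : Ω → Set (CoefSpace J K M)

/-- The `q`-quantile `inf {c : ν(ς ≤ c) ≥ q}` of an extended-real function `ς` under `ν`. -/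
def quantileUnder {E : Type*} [MeasurableSpace E] (ν : Measure E) (ς : E → EReal) (q : ℝ) :
    EReal :=
  sInf {c : EReal | q ≤ ν.real {y | ς y ≤ c}}

/-- `S` and `S'` are locally equal with radius `ε`: `ε > 0` and they coincide on the
`ε`-neighbourhood (open ball) of zero. -/
def LocallyEqual {E : Type*} [SeminormedAddCommGroup E] (S S' : Set E) (ε : ℝ) : Prop :=
  0 < ε ∧ S ∩ Metric.ball 0 ε = S' ∩ Metric.ball 0 ε

/-- The Frobenius norm of a real matrix. -/
def frobNorm {ι : Type*} [Fintype ι] (N : Matrix ι ι ℝ) : ℝ :=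
  Real.sqrt (∑ i, ∑ j, (N i j) ^ 2)

/-- The inverse square root `S^{-1/2}` of a positive definite matrix. (If `S` is not positive
definite then the value is that of a non-invertible matrix, namely `0`.) -/
def invSqrt {ι : Type*} [Fintype ι] [DecidableEq ι] (S : Matrix ι ι ℝ) : Matrix ι ι ℝ :=
  (CFC.sqrt S)⁻¹

/-- `{δ ∈ S : δ' Q δ - 2 ξ' δ ≤ 0}`. -/
def basicSet {ι : Type*} [Fintype ι] (S : Set (EuclideanSpace ℝ ι)) (Q : Matrix ι ι ℝ)
    (ξ : EuclideanSpace ℝ ι) : Set (EuclideanSpace ℝ ι) :=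
  {δ | δ ∈ S ∧ δ.ofLp ⬝ᵥ (Q *ᵥ δ.ofLp) - 2 * (ξ.ofLp ⬝ᵥ δ.ofLp) ≤ 0}

namespace SCModel

/-- The stacked vector `A ∈ ℝ^{T₀ M}`. -/
def Avec {Ω : Type*} {T₀ J K M : ℕ} (m : SCModel Ω T₀ J K M) (ω : Ω) : Fin T₀ × Fin M → ℝ :=
  fun i => m.A ω i.2 i.1

/-- The stacked matrix `B`, of size `T₀ M × J`. -/
def Bmat {Ω : Type*} {T₀ J K M : ℕ} (m : SCModel Ω T₀ J K M) (ω : Ω) :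
    Matrix (Fin T₀ × Fin M) (Fin J) ℝ :=
  Matrix.of fun i j => m.B ω i.2 i.1 j

/-- The block diagonal matrix `C = diag(C_1, …, C_M)`, of size `T₀ M × K M`. -/
def Cmat {Ω : Type*} {T₀ J K M : ℕ} (m : SCModel Ω T₀ J K M) (ω : Ω) :
    Matrix (Fin T₀ × Fin M) (Fin K × Fin M) ℝ :=
  Matrix.blockDiagonal fun l => Matrix.of (m.C ω l)

/-- `Z = (B, C)`, so that `Z β = B w + C r`. -/
def Z {Ω : Type*} {T₀ J K M : ℕ} (m : SCModel Ω T₀ J K M) (ω : Ω) :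
    Matrix (Fin T₀ × Fin M) (CoefIdx J K M) ℝ :=
  Matrix.fromCols (m.Bmat ω) (m.Cmat ω)

/-- `p_T = (x_T, g_T)`. -/
def p {Ω : Type*} {T₀ J K M : ℕ} (m : SCModel Ω T₀ J K M) (ω : Ω) : CoefIdx J K M → ℝ :=
  Sum.elim (m.x ω) (m.g ω)

/-- The diagonal scaling matrix `D`. -/
def D {Ω : Type*} {T₀ J K M : ℕ} (m : SCModel Ω T₀ J K M) :
    Matrix (CoefIdx J K M) (CoefIdx J K M) ℝ :=
  Matrix.diagonal m.scale

/-- The product feasibility set `W × R` for `β = (w, r)`. -/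
def feasible {Ω : Type*} {T₀ J K M : ℕ} (m : SCModel Ω T₀ J K M) : Set (CoefIdx J K M → ℝ) :=
  {β | (fun j => β (Sum.inl j)) ∈ m.W ∧ (fun k => β (Sum.inr k)) ∈ m.R}

/-- The conditioning variables `(B, C, x_T, g_T)`. -/
def info {Ω : Type*} {T₀ J K M : ℕ} (m : SCModel Ω T₀ J K M) (ω : Ω) :
    (Fin M → Fin T₀ → Fin J → ℝ) × (Fin M → Fin T₀ → Fin K → ℝ) ×
      (Fin J → ℝ) × (Fin K × Fin M → ℝ) :=
  (m.B ω, m.C ω, m.x ω, m.g ω)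

/-- The conditioning σ-field `ℋ = σ(B, C, x_T, g_T)`. -/
abbrev H {Ω : Type*} {T₀ J K M : ℕ} (m : SCModel Ω T₀ J K M) : MeasurableSpace Ω :=
  MeasurableSpace.comap m.info inferInstance

/-- The sum of squares `(a - Z β)' (a - Z β)`. -/
def sumSq {Ω : Type*} {T₀ J K M : ℕ} (m : SCModel Ω T₀ J K M) (ω : Ω)
    (a : Fin T₀ × Fin M → ℝ) (β : CoefIdx J K M → ℝ) : ℝ :=
  (a - m.Z ω *ᵥ β) ⬝ᵥ (a - m.Z ω *ᵥ β)

/-- The conditional criterion `E[(A - B w - C r)' (A - B w - C r) | ℋ]`, an element of `[0, ∞]`.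
It is written with the regular conditional distribution of `A` given `(B, C, x_T, g_T)`, which
gives a version for all `β` at once; `Z` is a function of the conditioning variables. -/
def popCriterion {Ω : Type*} [MeasurableSpace Ω] {T₀ J K M : ℕ} (m : SCModel Ω T₀ J K M)
    (P : Measure Ω) [IsFiniteMeasure P] (ω : Ω) (β : CoefIdx J K M → ℝ) : ℝ≥0∞ :=
  ∫⁻ a, ENNReal.ofReal (m.sumSq ω a β) ∂(condDistrib m.Avec m.info P (m.info ω))

/-- The constrained least squares problem: `βhat` is a minimizer, almost surely. -/
def IsEstimator {Ω : Type*} [MeasurableSpace Ω] {T₀ J K M : ℕ} (m : SCModel Ω T₀ J K M)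
    (P : Measure Ω) : Prop :=
  Measurable m.βhat ∧
    ∀ᵐ ω ∂P, m.βhat ω ∈ m.feasible ∧ IsMinOn (m.sumSq ω (m.Avec ω)) m.feasible (m.βhat ω)

/-- `β₀` is the (`ℋ`-measurable) minimizer of the conditional criterion, almost surely. -/
def IsPseudoTrue {Ω : Type*} [MeasurableSpace Ω] {T₀ J K M : ℕ} (m : SCModel Ω T₀ J K M)
    (P : Measure Ω) [IsFiniteMeasure P] : Prop :=
  Measurable[m.H] m.β₀ ∧
    ∀ᵐ ω ∂P, m.β₀ ω ∈ m.feasible ∧ IsMinOn (m.popCriterion P ω) m.feasible (m.β₀ ω)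

/-- The pseudo-true residual `U = A - B w₀ - C r₀`. -/
def U {Ω : Type*} {T₀ J K M : ℕ} (m : SCModel Ω T₀ J K M) (ω : Ω) : Fin T₀ × Fin M → ℝ :=
  m.Avec ω - m.Z ω *ᵥ m.β₀ ω

/-- `Q̂ = D⁻¹ Z' Z D⁻¹`. -/
def Qhat {Ω : Type*} {T₀ J K M : ℕ} (m : SCModel Ω T₀ J K M) (ω : Ω) :
    Matrix (CoefIdx J K M) (CoefIdx J K M) ℝ :=
  (m.D)⁻¹ * (m.Z ω)ᵀ * m.Z ω * (m.D)⁻¹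

/-- `γ̂`, defined by `γ̂' = U' Z D⁻¹`. -/
def gammaHat {Ω : Type*} {T₀ J K M : ℕ} (m : SCModel Ω T₀ J K M) (ω : Ω) :
    CoefIdx J K M → ℝ :=
  m.U ω ᵥ* (m.Z ω * (m.D)⁻¹)

/-- `Σ = V[γ̂ | ℋ]`: the covariance matrix of the regular conditional distribution of `γ̂` given
`(B, C, x_T, g_T)`. -/
def Sigma {Ω : Type*} [MeasurableSpace Ω] {T₀ J K M : ℕ} (m : SCModel Ω T₀ J K M)
    (P : Measure Ω) [IsFiniteMeasure P] (ω : Ω) : Matrix (CoefIdx J K M) (CoefIdx J K M) ℝ :=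
  Matrix.of fun i j =>
    covariance (fun y : CoefIdx J K M → ℝ => y i) (fun y => y j)
      (condDistrib m.gammaHat m.info P (m.info ω))

/-- `Δ = {D (β - β₀) : β ∈ W × R}`. -/
def Delta {Ω : Type*} {T₀ J K M : ℕ} (m : SCModel Ω T₀ J K M) (ω : Ω) :
    Set (CoefSpace J K M) :=
  {h | ∃ β ∈ m.feasible, h = WithLp.toLp 2 (m.D *ᵥ (β - m.β₀ ω))}

/-- `δ̂ = D (β̂ - β₀)`. -/
def deltaHat {Ω : Type*} {T₀ J K M : ℕ} (m : SCModel Ω T₀ J K M) (ω : Ω) : CoefSpace J K M :=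
  WithLp.toLp 2 (m.D *ᵥ (m.βhat ω - m.β₀ ω))

/-- The linear functional `δ ↦ p_T' D⁻¹ δ`. -/
def target {Ω : Type*} {T₀ J K M : ℕ} (m : SCModel Ω T₀ J K M) (ω : Ω)
    (δ : CoefSpace J K M) : ℝ :=
  m.p ω ⬝ᵥ ((m.D)⁻¹ *ᵥ δ.ofLp)

/-- `sup {p_T' D⁻¹ δ : δ ∈ S, δ' Q̂ δ - 2 ξ' δ ≤ 0}`, in the extended reals
(`-∞` for the empty set, `+∞` if unbounded). -/
def supTarget {Ω : Type*} {T₀ J K M : ℕ} (m : SCModel Ω T₀ J K M) (ω : Ω)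
    (S : Set (CoefSpace J K M)) (ξ : CoefSpace J K M) : EReal :=
  ⨆ δ ∈ basicSet S (m.Qhat ω) ξ, ((m.target ω δ : ℝ) : EReal)

/-- The law `N(0, Σ)` of `G` conditional on `ℋ`. -/
def lawG {Ω : Type*} [MeasurableSpace Ω] {T₀ J K M : ℕ} (m : SCModel Ω T₀ J K M)
    (P : Measure Ω) [IsFiniteMeasure P] (ω : Ω) : Measure (CoefSpace J K M) :=
  multivariateGaussian 0 (m.Sigma P ω)

/-- The law `N(0, Σ̂)` of `G⋆` conditional on the data. -/
def lawGStar {Ω : Type*} {T₀ J K M : ℕ} (m : SCModel Ω T₀ J K M) (ω : Ω) :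
    Measure (CoefSpace J K M) :=
  multivariateGaussian 0 (m.SigmaHat ω)

/-- `c†(q)`: the `q`-quantile, conditional on `ℋ`, of
`sup {p_T' D⁻¹ δ : δ ∈ Δ, δ' Q̂ δ - 2 G' δ ≤ 0}`, where `G | ℋ ∼ N(0, Σ)`. -/
def cDagger {Ω : Type*} [MeasurableSpace Ω] {T₀ J K M : ℕ} (m : SCModel Ω T₀ J K M)
    (P : Measure Ω) [IsFiniteMeasure P] (q : ℝ) (ω : Ω) : EReal :=
  quantileUnder (m.lawG P ω) (m.supTarget ω (m.Delta ω)) q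

/-- `c⋆(q)`: the `q`-quantile, conditional on the data, of
`sup {p_T' D⁻¹ δ : δ ∈ Δ⋆, δ' Q̂ δ - 2 G⋆' δ ≤ 0}`, where `G⋆ ∼ N(0, Σ̂)`. -/
def cStar {Ω : Type*} {T₀ J K M : ℕ} (m : SCModel Ω T₀ J K M) (q : ℝ) (ω : Ω) : EReal :=
  quantileUnder (m.lawGStar ω) (m.supTarget ω (m.DeltaStar ω)) q

end SCModel

end

/-! Freeze the conditioning variables and compare the two quantiles pointwise. Take `Σ` positive
definite, `Δ⋆` locally equal to `Δ`, and `Σ̂` relatively close to `Σ`. If the set cut out by `G` in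
`Δ` stays within the radius of local equality, every point of it can be shrunk slightly towards
zero. The shrunk point still satisfies the quadratic inequality, by convexity and `Q̂ ≥ 0`, and it
lies in `Δ⋆`. So the supremum over `Δ` is at most the one over `Δ⋆`
(`iSup_basicSet_le_of_locallyEqual`). Replacing `N(0, Σ̂)` by `N(0, Σ)` changes probabilities by at
most `εγ1` (`multivariateGaussian_le_add`), and leaving the radius costs at most `εδ`. Hence `c†(1 -
α - εδ - εγ1) ≤ c⋆(1 - α)` (`SCModel.cDagger_le_cStar`).

Coverage by `c†` at level `α + εδ + εγ1` therefore passes to `c⋆`. A conditional Bonferroni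
inequality adds the losses `εΔ` and `εγ2`, and an unconditional union bound adds the four `π`'s.

The Gaussian comparison bounds total variation by Hellinger affinity. Simultaneous diagonalization
turns both laws into images of product Gaussians, for which the affinity is explicit.

The remaining work is measurability. The supremum involves an arbitrary convex set, so the
localization event is replaced by a closed convex set of `ξ` that differs from it by a null set and
whose Gaussian mass is `ℋ`-measurable. The events under conditional probabilities are measurable up
to null sets because otherwise the conditional expectation would be zero and the assumed lower
bounds would fail. -/

open scoped NNReal

/-! ### Total variation comparison of centred Gaussian laws -/

/-- Two probability densities whose Hellinger affinity `b` satisfies `1 - b² ≤ ε²` differ by at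
most `ε` on every measurable set. -/
theorem setIntegral_le_add_of_affinity {X : Type*} [MeasurableSpace X] {μ : Measure X}
    {f g : X → ℝ} (hf0 : ∀ x, 0 ≤ f x) (hg0 : ∀ x, 0 ≤ g x) (hf : Integrable f μ)
    (hg : Integrable g μ) (hf1 : ∫ x, f x ∂μ = 1) (hg1 : ∫ x, g x ∂μ = 1) {ε : ℝ} (hε : 0 ≤ ε)
    (hb : 1 - (∫ x, √(f x * g x) ∂μ) ^ 2 ≤ ε ^ 2) {S : Set X} (hS : MeasurableSet S) :
    ∫ x in S, f x ∂μ ≤ ∫ x in S, g x ∂μ + ε := by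
  set b := ∫ x, √(f x * g x) ∂μ with hbdef
  have hh2 : ∀ x, √(f x * g x) ^ 2 = f x * g x := fun x =>
    Real.sq_sqrt (mul_nonneg (hf0 x) (hg0 x))
  have hh : Integrable (fun x => √(f x * g x)) μ := by
    refine (hf.add hg).mono'
      ((hf.aestronglyMeasurable.mul hg.aestronglyMeasurable).aemeasurable.sqrt.aestronglyMeasurable)
      (Filter.Eventually.of_forall fun x => ?_)
    rw [Real.norm_of_nonneg (Real.sqrt_nonneg _)]
    have := hf0 x
    have := hg0 x
    refine Real.sqrt_le_iff.2 ⟨by simpa using add_nonneg (hf0 x) (hg0 x), ?_⟩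
    simp only [Pi.add_apply]
    nlinarith [mul_nonneg (hf0 x) (hg0 x)]
  have hb0 : 0 ≤ b := integral_nonneg fun x => Real.sqrt_nonneg _
  -- Since `|f - g| = |√f - √g| (√f + √g)`, a weighted AM-GM inequality with free weight `t`
  -- replaces Cauchy–Schwarz. The factor 2 arises because `f - g` has integral zero, so `S` and its
  -- complement contribute equally.
  have key : ∀ t : ℝ, 0 < t →
      2 * (∫ x in S, f x ∂μ - ∫ x in S, g x ∂μ) ≤ t * (1 - b) + t⁻¹ * (1 + b) := by
    intro t ht
    have hfg := hf.sub hg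
    have h1 : ∫ x in S, f x ∂μ - ∫ x in S, g x ∂μ = ∫ x in S, (f - g) x ∂μ :=
      (integral_sub hf.integrableOn hg.integrableOn).symm
    have h2 : ∫ x in S, (f - g) x ∂μ + ∫ x in Sᶜ, (f - g) x ∂μ = 0 := by
      rw [integral_add_compl hS hfg]
      have := integral_sub hf hg
      simp only [Pi.sub_apply]
      rw [this, hf1, hg1, sub_self]
    have h3 : ∫ x in S, (f - g) x ∂μ - ∫ x in Sᶜ, (f - g) x ∂μ ≤ ∫ x, |(f - g) x| ∂μ := by
      rw [← integral_add_compl hS hfg.abs]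
      have a1 := abs_integral_le_integral_abs (μ := μ.restrict S) (f := f - g)
      have a2 := abs_integral_le_integral_abs (μ := μ.restrict Sᶜ) (f := f - g)
      have a3 := le_abs_self (∫ x in S, (f - g) x ∂μ)
      have a4 := neg_abs_le (∫ x in Sᶜ, (f - g) x ∂μ)
      linarith
    have h4 : ∫ x, |(f - g) x| ∂μ ≤ ∫ x, (t / 2 * (f x + g x - 2 * √(f x * g x))
        + t⁻¹ / 2 * (f x + g x + 2 * √(f x * g x))) ∂μ := by
      refine integral_mono hfg.abs ((((hf.add hg).sub (hh.const_mul 2)).const_mul _).add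
        (((hf.add hg).add (hh.const_mul 2)).const_mul _)) fun x => ?_
      have hx := hh2 x
      have hfx := hf0 x
      have hgx := hg0 x
      simp only [Pi.sub_apply]
      set h := √(f x * g x)
      have hh0 : 0 ≤ h := Real.sqrt_nonneg _
      have hp : 0 ≤ f x + g x - 2 * h := by
        nlinarith [sq_nonneg (f x - g x), sq_nonneg (f x + g x - 2 * h)]
      have hq : 0 ≤ f x + g x + 2 * h := by positivity
      refine abs_le_of_sq_le_sq ?_ (by positivity)
      have hpq : (f x - g x) ^ 2 = (f x + g x - 2 * h) * (f x + g x + 2 * h) := by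
        nlinarith
      rw [hpq]
      have hti : t * t⁻¹ = 1 := mul_inv_cancel₀ ht.ne'
      generalize f x + g x - 2 * h = p at *
      generalize f x + g x + 2 * h = q at *
      have : (t / 2 * p + t⁻¹ / 2 * q) ^ 2 - p * q
          = (t / 2 * p - t⁻¹ / 2 * q) ^ 2 + (t * t⁻¹ - 1) * (p * q) := by ring
      rw [hti] at this
      nlinarith [sq_nonneg (t / 2 * p - t⁻¹ / 2 * q)]
    have h5 : ∫ x, (t / 2 * (f x + g x - 2 * √(f x * g x))
        + t⁻¹ / 2 * (f x + g x + 2 * √(f x * g x))) ∂μ = t * (1 - b) + t⁻¹ * (1 + b) := by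
      have hfg' : Integrable (fun x => f x + g x) μ := hf.add hg
      have hi1 : Integrable (fun x => f x + g x - 2 * √(f x * g x)) μ := hfg'.sub (hh.const_mul 2)
      have hi2 : Integrable (fun x => f x + g x + 2 * √(f x * g x)) μ := hfg'.add (hh.const_mul 2)
      rw [integral_add (hi1.const_mul _) (hi2.const_mul _), integral_const_mul, integral_const_mul,
        integral_sub hfg' (hh.const_mul 2), integral_add hfg' (hh.const_mul 2),
        integral_add hf hg, integral_const_mul, hf1, hg1, ← hbdef]
      ring
    linarith
  -- The weight `t = (1 + b) / e` gives `(1 - b²) / e + e ≤ 2 e`. Taking `e > ε` avoids dividing by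
  -- zero when `ε = 0`.
  have hlim : ∀ e : ℝ, ε < e → ∫ x in S, f x ∂μ - ∫ x in S, g x ∂μ ≤ e := by
    intro e he
    have he0 : 0 < e := hε.trans_lt he
    have hk := key ((1 + b) / e) (by positivity)
    have e1 : (1 + b) / e * (1 - b) = (1 - b ^ 2) / e := by ring
    have e2 : ((1 + b) / e)⁻¹ * (1 + b) = e := by
      have : (1 + b) ≠ 0 := by positivity
      field_simp
    rw [e1, e2] at hk
    have : (1 - b ^ 2) / e ≤ e := by
      rw [div_le_iff₀ he0]
      nlinarith
    linarith
  have := le_of_forall_gt_imp_ge_of_dense hlim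
  linarith

theorem pi_withDensity_ofReal {ι : Type*} [Fintype ι] {f : ι → ℝ → ℝ}
    (hf0 : ∀ i x, 0 ≤ f i x) (hf : ∀ i, Integrable (f i))
    [∀ i, SigmaFinite ((volume : Measure ℝ).withDensity fun x => ENNReal.ofReal (f i x))] :
    Measure.pi (fun i => (volume : Measure ℝ).withDensity fun x => ENNReal.ofReal (f i x))
      = (volume : Measure (ι → ℝ)).withDensity fun x => ENNReal.ofReal (∏ i, f i (x i)) := by
  refine Measure.pi_eq fun s hs => ?_
  rw [withDensity_apply _ (MeasurableSet.univ_pi hs), volume_pi, Measure.restrict_pi_pi,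
    ← ofReal_integral_eq_lintegral_ofReal (Integrable.fintype_prod fun i => (hf i).restrict)
      (Filter.Eventually.of_forall fun x => Finset.prod_nonneg fun i _ => hf0 i _),
    integral_fintype_prod_eq_prod, ENNReal.ofReal_prod_of_nonneg]
  · refine Finset.prod_congr rfl fun i _ => ?_
    rw [withDensity_apply _ (hs i), ← ofReal_integral_eq_lintegral_ofReal (hf i).restrict
      (Filter.Eventually.of_forall fun x => hf0 i x)]
  · exact fun i _ => integral_nonneg fun x => hf0 i x

/-- The geometric mean of the two densities is again an unnormalized Gaussian, with exponent `-(1 +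
v) x² / (4 v)`. Squaring the affinity avoids a fourth root of `v`. -/
theorem integral_sqrt_gaussianPDFReal_mul {v : ℝ≥0} (hv : v ≠ 0) :
    (∫ x, √(gaussianPDFReal 0 v x * gaussianPDFReal 0 1 x)) ^ 2 = 2 * √v / (1 + v) := by
  have hv' : (0 : ℝ) < v := by positivity
  have h : ∀ x : ℝ, √(gaussianPDFReal 0 v x * gaussianPDFReal 0 1 x)
      = √((√(2 * Real.pi * v))⁻¹ * (√(2 * Real.pi))⁻¹)
        * Real.exp (-((1 + v) / (4 * v)) * x ^ 2) := by
    intro x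
    simp only [gaussianPDFReal_def]
    rw [show (√(2 * Real.pi * v))⁻¹ * Real.exp (-(x - 0) ^ 2 / (2 * v))
        * ((√(2 * Real.pi * ((1 : ℝ≥0) : ℝ)))⁻¹ * Real.exp (-(x - 0) ^ 2 / (2 * ((1 : ℝ≥0) : ℝ))))
        = (√(2 * Real.pi * v))⁻¹ * (√(2 * Real.pi))⁻¹
          * (Real.exp (-((1 + v) / (4 * v)) * x ^ 2)) ^ 2 by
      rw [← Real.exp_nat_mul]
      simp only [NNReal.coe_one, mul_one, sub_zero]
      rw [mul_mul_mul_comm, ← Real.exp_add]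
      congr 2
      push_cast
      field_simp
      ring]
    rw [Real.sqrt_mul (by positivity), Real.sqrt_sq (Real.exp_nonneg _)]
  simp_rw [h]
  rw [integral_const_mul, integral_gaussian, mul_pow, Real.sq_sqrt (by positivity),
    Real.sq_sqrt (by positivity), Real.sqrt_mul (by positivity)]
  have h2 : √(2 * Real.pi) ^ 2 = 2 * Real.pi := Real.sq_sqrt (by positivity)
  have h3 : √(v : ℝ) ^ 2 = v := Real.sq_sqrt hv'.le
  have h4 : 0 < √(2 * Real.pi) := by positivity
  have h5 : 0 < √(v : ℝ) := by positivity
  have : (√(2 * Real.pi) * √(v : ℝ))⁻¹ * (√(2 * Real.pi))⁻¹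
      = (√(2 * Real.pi) ^ 2)⁻¹ * (√(v : ℝ))⁻¹ := by
    field_simp
  rw [this, h2]
  have hpi := Real.pi_pos
  field_simp
  nlinarith

/-- Turns the affinity of product measures, which is a product over coordinates, into a sum of
coordinatewise losses. -/
theorem one_sub_prod_le_sum {ι : Type*} (s : Finset ι) {f : ι → ℝ} (h0 : ∀ i ∈ s, 0 ≤ f i)
    (h1 : ∀ i ∈ s, f i ≤ 1) : 1 - ∏ i ∈ s, f i ≤ ∑ i ∈ s, (1 - f i) := by
  classical
  induction s using Finset.induction_on with
  | empty => simp
  | insert a s ha ih =>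
    rw [Finset.prod_insert ha, Finset.sum_insert ha]
    have hp : ∏ i ∈ s, f i ≤ 1 :=
      Finset.prod_le_one (fun i hi => h0 i (Finset.mem_insert_of_mem hi))
        fun i hi => h1 i (Finset.mem_insert_of_mem hi)
    have := ih (fun i hi => h0 i (Finset.mem_insert_of_mem hi))
        fun i hi => h1 i (Finset.mem_insert_of_mem hi)
    have ha0 := h0 a (Finset.mem_insert_self _ _)
    have ha1 := h1 a (Finset.mem_insert_self _ _)
    nlinarith

/-- Total variation bound between a product of centred Gaussians with variances near `1` and the
standard Gaussian product. -/
theorem pi_gaussianReal_le_add {ι : Type*} [Fintype ι] {v : ι → ℝ≥0} {ε : ℝ} (hε : 0 ≤ ε)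
    (hv : ∀ i, |(v i : ℝ) - 1| ≤ 1 / 2) (hs : ∑ i, ((v i : ℝ) - 1) ^ 2 ≤ (2 * ε) ^ 2)
    {S : Set (ι → ℝ)} (hS : MeasurableSet S) :
    (Measure.pi fun i => gaussianReal 0 (v i)).real S
      ≤ (Measure.pi fun _ : ι => gaussianReal 0 1).real S + ε := by
  have hv0 : ∀ i, v i ≠ 0 := by
    intro i h
    have := hv i
    rw [h] at this
    norm_num at this
  have main : ∀ w : ι → ℝ≥0, (∀ i, w i ≠ 0) →
      (Measure.pi fun i => gaussianReal 0 (w i)).real S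
        = ∫ x in S, ∏ i, gaussianPDFReal 0 (w i) (x i) := by
    intro w hw
    have hw' : (fun i => gaussianReal 0 (w i)) = fun i => (volume : Measure ℝ).withDensity
        fun x => ENNReal.ofReal (gaussianPDFReal 0 (w i) x) := by
      funext i
      rw [gaussianReal_of_var_ne_zero _ (hw i)]
      rfl
    have : ∀ i, SigmaFinite ((volume : Measure ℝ).withDensity
        fun x => ENNReal.ofReal (gaussianPDFReal 0 (w i) x)) := fun i => by
      rw [← congrFun hw' i]
      infer_instance
    simp_rw [hw']
    rw [Measure.real, pi_withDensity_ofReal (fun i => gaussianPDFReal_nonneg _ _)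
      (fun i => integrable_gaussianPDFReal _ _), withDensity_apply _ hS,
      integral_eq_lintegral_of_nonneg_ae]
    · exact Filter.Eventually.of_forall fun x =>
        Finset.prod_nonneg fun i _ => gaussianPDFReal_nonneg _ _ _
    · exact (Integrable.fintype_prod fun i =>
        integrable_gaussianPDFReal 0 (w i)).aestronglyMeasurable.restrict
  have hint : ∀ w : ι → ℝ≥0, Integrable fun x : ι → ℝ => ∏ i, gaussianPDFReal 0 (w i) (x i) :=
    fun w => Integrable.fintype_prod fun i => integrable_gaussianPDFReal 0 (w i)
  have hone : ∀ w : ι → ℝ≥0, (∀ i, w i ≠ 0) →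
      ∫ x : ι → ℝ, ∏ i, gaussianPDFReal 0 (w i) (x i) = 1 := by
    intro w hw
    rw [integral_fintype_prod_volume_eq_prod]
    exact Finset.prod_eq_one fun i _ => integral_gaussianPDFReal_eq_one _ (hw i)
  rw [main v hv0, main (fun _ => 1) fun _ => one_ne_zero]
  refine setIntegral_le_add_of_affinity
    (fun x => Finset.prod_nonneg fun i _ => gaussianPDFReal_nonneg _ _ _)
    (fun x => Finset.prod_nonneg fun i _ => gaussianPDFReal_nonneg _ _ _) (hint _) (hint _)
    (hone _ hv0) (hone _ fun _ => one_ne_zero) hε ?_ hS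
  have h1 : ∀ x : ι → ℝ, √((∏ i, gaussianPDFReal 0 (v i) (x i)) * ∏ i, gaussianPDFReal 0 1 (x i))
      = ∏ i, √(gaussianPDFReal 0 (v i) (x i) * gaussianPDFReal 0 1 (x i)) := by
    intro x
    rw [← Finset.prod_mul_distrib, Real.sqrt_prod]
    exact fun i _ => mul_nonneg (gaussianPDFReal_nonneg _ _ _) (gaussianPDFReal_nonneg _ _ _)
  simp_rw [h1]
  rw [integral_fintype_prod_volume_eq_prod
      (fun i y => √(gaussianPDFReal 0 (v i) y * gaussianPDFReal 0 1 y)), ← Finset.prod_pow]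
  simp_rw [integral_sqrt_gaussianPDFReal_mul (hv0 _)]
  have hsq : ∀ i, √(v i : ℝ) ^ 2 = v i := fun i => Real.sq_sqrt (v i).2
  have hpos : ∀ i, (0 : ℝ) < 1 + v i := fun i => by positivity
  refine (one_sub_prod_le_sum _ (fun i _ => by positivity) fun i _ => ?_).trans ?_
  · rw [div_le_one (hpos i)]
    nlinarith [hsq i, sq_nonneg (√(v i : ℝ) - 1)]
  · have : ∑ i, (1 - 2 * √(v i : ℝ) / (1 + v i)) ≤ ∑ i, ((v i : ℝ) - 1) ^ 2 / 4 := by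
      refine Finset.sum_le_sum fun i _ => ?_
      have hq := hsq i
      have hb := (abs_le.1 (hv i)).1
      -- From `v ≥ 1/2`. This makes `(q + 1)² (1 + q²) ≥ 4`, so each loss `(q - 1)² / (1 + q²)` is
      -- at most `(q² - 1)² / 4`. The quarter turns `(2 ε)²` into `ε²`.
      have h7 : (7 : ℝ) / 10 ≤ √(v i : ℝ) := Real.le_sqrt_of_sq_le (by linarith)
      set q := √(v i : ℝ)
      rw [← hq] at hb ⊢
      have hpq : 0 < 1 + q ^ 2 := by positivity
      rw [show 1 - 2 * q / (1 + q ^ 2) = (q - 1) ^ 2 / (1 + q ^ 2) by field_simp; ring,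
        div_le_div_iff₀ hpq (by norm_num)]
      have : 4 ≤ (q + 1) ^ 2 * (1 + q ^ 2) := by nlinarith
      nlinarith [mul_le_mul_of_nonneg_left this (sq_nonneg (q - 1))]
    rw [← Finset.sum_div] at this
    linarith

/-- Both sides have the same characteristic function. It lets two Gaussians sharing the factor `B`
be compared through product measures under one common linear map. -/
theorem multivariateGaussian_mul_diagonal_mul_transpose {ι : Type*} [Fintype ι] [DecidableEq ι]
    (B : Matrix ι ι ℝ) (v : ι → ℝ≥0) :
    multivariateGaussian 0 (B * Matrix.diagonal (fun i => (v i : ℝ)) * Bᵀ)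
      = (Measure.pi fun i => gaussianReal 0 (v i)).map (fun x => WithLp.toLp 2 (B *ᵥ x)) := by
  have hmeas : Measurable fun x : ι → ℝ => WithLp.toLp 2 (B *ᵥ x) := by fun_prop
  have hpsd : (B * Matrix.diagonal (fun i => (v i : ℝ)) * Bᵀ).PosSemidef := by
    have := (Matrix.PosSemidef.diagonal (d := fun i => (v i : ℝ))
      (fun i => (v i).2)).mul_mul_conjTranspose_same B
    rwa [Matrix.conjTranspose_eq_transpose_of_trivial] at this
  have := Measure.isProbabilityMeasure_map (μ := Measure.pi fun i => gaussianReal 0 (v i))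
    hmeas.aemeasurable
  apply Measure.ext_of_charFun
  ext t
  rw [charFun_multivariateGaussian hpsd]
  have h1 : charFun ((Measure.pi fun i => gaussianReal 0 (v i)).map
      (fun x => WithLp.toLp 2 (B *ᵥ x))) t
      = charFun ((Measure.pi fun i => gaussianReal 0 (v i)).map (WithLp.toLp 2))
        (WithLp.toLp 2 (Bᵀ *ᵥ t.ofLp)) := by
    rw [charFun_apply, charFun_apply, integral_map hmeas.aemeasurable (by fun_prop),
      integral_map (by fun_prop) (by fun_prop)]
    refine integral_congr_ae (Filter.Eventually.of_forall fun x => ?_)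
    have hin : inner ℝ (WithLp.toLp 2 (B *ᵥ x)) t
        = inner ℝ (WithLp.toLp 2 x : EuclideanSpace ℝ ι) (WithLp.toLp 2 (Bᵀ *ᵥ t.ofLp)) := by
      rw [show t = WithLp.toLp 2 t.ofLp from rfl, EuclideanSpace.inner_toLp_toLp,
        EuclideanSpace.inner_toLp_toLp]
      simp only [star_trivial]
      rw [Matrix.dotProduct_mulVec, Matrix.mulVec_transpose]
    simp only [hin]
  rw [h1, charFun_pi]
  simp_rw [charFun_gaussianReal]
  rw [← Complex.exp_sum]
  congr 1
  simp only [inner_zero_right, Complex.ofReal_zero, zero_mul, mul_zero, zero_sub]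
  rw [Finset.sum_neg_distrib, ← Finset.sum_div]
  congr 2
  have h2 : t.ofLp ⬝ᵥ (B * Matrix.diagonal (fun i => (v i : ℝ)) * Bᵀ) *ᵥ t.ofLp
      = ∑ i, (v i : ℝ) * ((Bᵀ *ᵥ t.ofLp) i) ^ 2 := by
    rw [← Matrix.mulVec_mulVec, ← Matrix.mulVec_mulVec, Matrix.dotProduct_mulVec,
      ← Matrix.mulVec_transpose]
    simp only [dotProduct, Matrix.mulVec_diagonal]
    exact Finset.sum_congr rfl fun i _ => by ring
  have h3 := congrArg (fun r : ℝ => (r : ℂ)) h2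
  push_cast at h3
  exact_mod_cast h3

theorem frobNorm_sq_eq_trace {ι : Type*} [Fintype ι] (N : Matrix ι ι ℝ) :
    frobNorm N ^ 2 = (N * Nᵀ).trace := by
  have h : frobNorm N ^ 2 = ∑ i, ∑ j, N i j ^ 2 :=
    Real.sq_sqrt (Finset.sum_nonneg fun i _ => Finset.sum_nonneg fun j _ => sq_nonneg _)
  rw [h]
  simp [Matrix.trace, Matrix.mul_apply, sq]

/-- The Frobenius norm is invariant under orthogonal conjugation, so it can be read off after
diagonalizing. -/
theorem frobNorm_sq_sub_one_eq_sum_eigenvalues {ι : Type*} [Fintype ι] [DecidableEq ι]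
    {N : Matrix ι ι ℝ} (hN : N.IsHermitian) :
    frobNorm (N - 1) ^ 2 = ∑ i, (hN.eigenvalues i - 1) ^ 2 := by
  have hO : (hN.eigenvectorUnitary : Matrix ι ι ℝ)ᵀ * (hN.eigenvectorUnitary : Matrix ι ι ℝ) = 1 := by
    have := Matrix.UnitaryGroup.star_mul_self hN.eigenvectorUnitary
    rwa [Matrix.star_eq_conjTranspose, Matrix.conjTranspose_eq_transpose_of_trivial] at this
  have hO' : (hN.eigenvectorUnitary : Matrix ι ι ℝ) * (hN.eigenvectorUnitary : Matrix ι ι ℝ)ᵀ = 1 :=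
    mul_eq_one_comm.1 hO
  have hsp : N = (hN.eigenvectorUnitary : Matrix ι ι ℝ) * Matrix.diagonal hN.eigenvalues
      * (hN.eigenvectorUnitary : Matrix ι ι ℝ)ᵀ := by
    conv_lhs => rw [hN.spectral_theorem]
    rw [Unitary.conjStarAlgAut_apply, Matrix.star_eq_conjTranspose,
      Matrix.conjTranspose_eq_transpose_of_trivial]
    rfl
  have hsub : N - 1 = (hN.eigenvectorUnitary : Matrix ι ι ℝ)
      * Matrix.diagonal (fun i => hN.eigenvalues i - 1)
      * (hN.eigenvectorUnitary : Matrix ι ι ℝ)ᵀ := by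
    have hd : Matrix.diagonal (fun i => hN.eigenvalues i - 1)
        = Matrix.diagonal hN.eigenvalues - 1 := by
      rw [← Matrix.diagonal_one, Matrix.diagonal_sub]
    rw [hd, mul_sub, sub_mul, ← hsp, mul_one, hO']
  generalize (hN.eigenvectorUnitary : Matrix ι ι ℝ) = O at *
  rw [frobNorm_sq_eq_trace, hsub]
  simp only [Matrix.transpose_mul, Matrix.transpose_transpose, Matrix.diagonal_transpose]
  rw [show O * Matrix.diagonal (fun i => hN.eigenvalues i - 1) * Oᵀ
      * (O * (Matrix.diagonal (fun i => hN.eigenvalues i - 1) * Oᵀ))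
      = O * (Matrix.diagonal (fun i => hN.eigenvalues i - 1) * (Oᵀ * O)
        * Matrix.diagonal (fun i => hN.eigenvalues i - 1) * Oᵀ) by simp only [mul_assoc],
    Matrix.trace_mul_comm, hO, mul_one, mul_assoc, hO, mul_one, Matrix.diagonal_mul_diagonal,
    Matrix.trace_diagonal]
  exact Finset.sum_congr rfl fun i _ => by ring

theorem posSemidef_sqrt {ι : Type*} [Fintype ι] [DecidableEq ι] (S : Matrix ι ι ℝ) :
    (CFC.sqrt S).PosSemidef :=
  Matrix.nonneg_iff_posSemidef.1 (CFC.sqrt_nonneg S)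

theorem isUnit_det_sqrt {ι : Type*} [Fintype ι] [DecidableEq ι] {S : Matrix ι ι ℝ}
    (hS : S.PosDef) : IsUnit (CFC.sqrt S).det := by
  have h := CFC.sqrt_mul_sqrt_self S hS.posSemidef.nonneg
  have hd := congrArg Matrix.det h
  rw [Matrix.det_mul] at hd
  refine isUnit_iff_ne_zero.2 fun h0 => ?_
  rw [h0, zero_mul] at hd
  exact hS.det_pos.ne hd

/-- Without positive definiteness `invSqrt S` is zero by convention, and the norm becomes that of
`-1`, which is at least 1 in positive dimension. The closeness condition thus contains the
invertibility of `S`. -/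
theorem posDef_of_frobNorm_invSqrt_le {ι : Type*} [Fintype ι] [DecidableEq ι]
    {S T : Matrix ι ι ℝ} (h : frobNorm (invSqrt S * T * invSqrt S - 1) ≤ 1 / 2) : S.PosDef := by
  by_contra hS
  have hne : Nonempty ι := by
    by_contra hn
    rw [not_nonempty_iff] at hn
    exact hS (by rw [Subsingleton.elim S 1]; exact Matrix.PosDef.one)
  have hdet : (CFC.sqrt S).det = 0 := by
    by_cases hS' : S.PosSemidef
    · have h0 := mt hS'.posDef_iff_det_ne_zero.2 hS
      rw [not_not] at h0
      have h1 := congrArg Matrix.det (CFC.sqrt_mul_sqrt_self S hS'.nonneg)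
      rwa [Matrix.det_mul, h0, mul_self_eq_zero] at h1
    · rw [CFC.sqrt_of_not_nonneg fun h' => hS' (Matrix.nonneg_iff_posSemidef.1 h'), Matrix.det_zero]
  have h2 : invSqrt S = 0 := Matrix.nonsing_inv_apply_not_isUnit _ (by simp [hdet])
  have h3 := frobNorm_sq_eq_trace (invSqrt S * T * invSqrt S - 1)
  have h4 : (0 : ℝ) ≤ frobNorm (invSqrt S * T * invSqrt S - 1) := Real.sqrt_nonneg _
  rw [h2] at h3 h h4
  simp only [mul_zero, zero_sub, Matrix.transpose_neg, Matrix.transpose_one, neg_mul_neg, mul_one,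
    Matrix.trace_one] at h3 h h4
  have h5 : (1 : ℝ) ≤ Fintype.card ι := by exact_mod_cast Fintype.card_pos
  nlinarith

/-- Gaussian comparison: the laws `N(0, T)` and `N(0, S)` differ in total variation by at most half
the Frobenius distance of `S^{-1/2} T S^{-1/2}` from the identity. -/
theorem multivariateGaussian_le_add {ι : Type*} [Fintype ι] [DecidableEq ι] {S T : Matrix ι ι ℝ}
    (hS : S.PosDef) (hT : T.PosSemidef) {ε : ℝ} (hε : 0 ≤ ε) (hε' : ε ≤ 1 / 4)
    (h : frobNorm (invSqrt S * T * invSqrt S - 1) ≤ 2 * ε) (E : Set (EuclideanSpace ℝ ι)) :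
    (multivariateGaussian 0 T).real E ≤ (multivariateGaussian 0 S).real E + ε := by
  set r := CFC.sqrt S with hr
  have hrr : r * r = S := CFC.sqrt_mul_sqrt_self S hS.posSemidef.nonneg
  have hrt : rᵀ = r := by
    have := (posSemidef_sqrt S).isHermitian
    rwa [Matrix.IsHermitian, Matrix.conjTranspose_eq_transpose_of_trivial] at this
  have hu : IsUnit r.det := isUnit_det_sqrt hS
  set N := invSqrt S * T * invSqrt S with hN
  have hit : (invSqrt S)ᵀ = invSqrt S := by
    rw [invSqrt, Matrix.transpose_nonsing_inv, hrt]
  have hNpsd : N.PosSemidef := by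
    have := hT.mul_mul_conjTranspose_same (invSqrt S)
    rwa [Matrix.conjTranspose_eq_transpose_of_trivial, hit] at this
  have hNh := hNpsd.isHermitian
  have hTN : T = r * N * r := by
    rw [hN, invSqrt, ← hr]
    calc T = (r * r⁻¹) * T * (r⁻¹ * r) := by
          rw [Matrix.mul_nonsing_inv _ hu, Matrix.nonsing_inv_mul _ hu, one_mul, mul_one]
      _ = _ := by simp only [mul_assoc]
  have hO : (hNh.eigenvectorUnitary : Matrix ι ι ℝ)ᵀ * (hNh.eigenvectorUnitary : Matrix ι ι ℝ)
      = 1 := by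
    have := Matrix.UnitaryGroup.star_mul_self hNh.eigenvectorUnitary
    rwa [Matrix.star_eq_conjTranspose, Matrix.conjTranspose_eq_transpose_of_trivial] at this
  have hO' : (hNh.eigenvectorUnitary : Matrix ι ι ℝ) * (hNh.eigenvectorUnitary : Matrix ι ι ℝ)ᵀ
      = 1 := mul_eq_one_comm.1 hO
  have hsp : N = (hNh.eigenvectorUnitary : Matrix ι ι ℝ) * Matrix.diagonal hNh.eigenvalues
      * (hNh.eigenvectorUnitary : Matrix ι ι ℝ)ᵀ := by
    conv_lhs => rw [hNh.spectral_theorem]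
    rw [Unitary.conjStarAlgAut_apply, Matrix.star_eq_conjTranspose,
      Matrix.conjTranspose_eq_transpose_of_trivial]
    rfl
  have hfro := frobNorm_sq_sub_one_eq_sum_eigenvalues hNh
  have hf0 : (0 : ℝ) ≤ frobNorm (N - 1) := Real.sqrt_nonneg _
  have hsum : ∑ i, (hNh.eigenvalues i - 1) ^ 2 ≤ (2 * ε) ^ 2 := by
    rw [← hfro]
    exact pow_le_pow_left₀ hf0 h 2
  have hev0 : ∀ i, 0 ≤ hNh.eigenvalues i := hNpsd.eigenvalues_nonneg
  generalize (hNh.eigenvectorUnitary : Matrix ι ι ℝ) = O at *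
  generalize hNh.eigenvalues = ev at *
  set v : ι → ℝ≥0 := fun i => ⟨ev i, hev0 i⟩ with hvdef
  -- With `r = √S` and `O` the eigenvectors of `N`, one has `T = (r O) diag(ev) (r O)ᵀ` and `S = (r
  -- O) (r O)ᵀ`, so both laws are images under `r O`.
  have hTlaw := multivariateGaussian_mul_diagonal_mul_transpose (r * O) v
  have hSlaw := multivariateGaussian_mul_diagonal_mul_transpose (r * O) (fun _ => 1)
  have e1 : r * O * Matrix.diagonal (fun i => (v i : ℝ)) * (r * O)ᵀ = T := by
    rw [hTN, hsp, Matrix.transpose_mul, hrt]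
    simp only [mul_assoc]
    rfl
  have e2 : r * O * Matrix.diagonal (fun _ => ((1 : ℝ≥0) : ℝ)) * (r * O)ᵀ = S := by
    simp only [NNReal.coe_one, Matrix.diagonal_one]
    rw [mul_one, Matrix.transpose_mul, hrt, mul_assoc, ← mul_assoc O, hO', one_mul, hrr]
  rw [e1] at hTlaw
  rw [e2] at hSlaw
  have hmeas : Measurable fun x : ι → ℝ => WithLp.toLp 2 ((r * O) *ᵥ x) := by fun_prop
  -- `E` need not be measurable. A measurable hull taken with respect to `N(0, S)` suffices: it
  -- keeps the right-hand mass and can only increase the left-hand one.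
  have hle : (multivariateGaussian 0 T).real (toMeasurable (multivariateGaussian 0 S) E)
      ≤ (multivariateGaussian 0 S).real (toMeasurable (multivariateGaussian 0 S) E) + ε := by
    have hm := measurableSet_toMeasurable (multivariateGaussian 0 S) E
    generalize toMeasurable (multivariateGaussian 0 S) E = F at *
    rw [hTlaw, hSlaw, map_measureReal_apply hmeas hm, map_measureReal_apply hmeas hm]
    refine pi_gaussianReal_le_add hε (fun i => ?_) hsum (hmeas hm)
    refine abs_le_of_sq_le_sq ?_ (by norm_num)
    -- Each eigenvalue is within `2 ε ≤ 1/2` of 1, which is where `ε ≤ 1/4` enters.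
    refine (Finset.single_le_sum (f := fun i => (ev i - 1) ^ 2) (fun i _ => sq_nonneg _)
      (Finset.mem_univ i)).trans (hsum.trans ?_)
    exact pow_le_pow_left₀ (by positivity) (by linarith) 2
  refine (measureReal_mono (subset_toMeasurable (multivariateGaussian 0 S) E)).trans ?_
  rwa [measureReal_def (multivariateGaussian 0 S), measure_toMeasurable,
    ← measureReal_def] at hle

/-- Needed so that frontiers of convex sets, which are Lebesgue-null, are negligible for the
Gaussian law. -/
theorem multivariateGaussian_absolutelyContinuous {ι : Type*} [Fintype ι] [DecidableEq ι]
    {S : Matrix ι ι ℝ} (hS : S.PosDef) :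
    multivariateGaussian 0 S ≪ (volume : Measure (EuclideanSpace ℝ ι)) := by
  have hstd : stdGaussian (EuclideanSpace ℝ ι) ≪ volume := by
    rw [← map_pi_eq_stdGaussian, ← (PiLp.volume_preserving_toLp ι).map_eq]
    refine Measure.AbsolutelyContinuous.map ?_ (by fun_prop)
    have hg : (fun _ : ι => gaussianReal 0 1)
        = fun _ => (volume : Measure ℝ).withDensity fun x =>
          ENNReal.ofReal (gaussianPDFReal 0 1 x) := by
      funext i
      rw [gaussianReal_of_var_ne_zero _ one_ne_zero]
      rfl
    have : ∀ _ : ι, SigmaFinite ((volume : Measure ℝ).withDensity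
        fun x => ENNReal.ofReal (gaussianPDFReal 0 1 x)) := fun i => by
      rw [← congrFun hg i]
      infer_instance
    rw [hg, pi_withDensity_ofReal (fun i => gaussianPDFReal_nonneg _ _)
      (fun i => integrable_gaussianPDFReal _ _)]
    exact withDensity_absolutelyContinuous _ _
  have hu := isUnit_det_sqrt hS
  have hlin : LinearMap.det (toEuclideanCLM (𝕜 := ℝ) (CFC.sqrt S)
      : EuclideanSpace ℝ ι →ₗ[ℝ] EuclideanSpace ℝ ι) ≠ 0 := by
    have : (toEuclideanCLM (𝕜 := ℝ) (CFC.sqrt S)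
      : EuclideanSpace ℝ ι →ₗ[ℝ] EuclideanSpace ℝ ι) = Matrix.toEuclideanLin (CFC.sqrt S) := rfl
    rw [this, Matrix.toEuclideanLin, Matrix.toLpLin_eq_toLin, LinearMap.det_toLin]
    exact hu.ne_zero
  rw [multivariateGaussian]
  simp only [zero_add]
  refine (hstd.map (f := toEuclideanCLM (𝕜 := ℝ) (CFC.sqrt S)) (by fun_prop)).trans ?_
  have := Measure.map_linearMap_addHaar_eq_smul_addHaar
    (volume : Measure (EuclideanSpace ℝ ι)) hlin
  change Measure.map (⇑(toEuclideanCLM (𝕜 := ℝ) (CFC.sqrt S)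
      : EuclideanSpace ℝ ι →ₗ[ℝ] EuclideanSpace ℝ ι)) volume ≪ volume
  rw [this]
  exact Measure.smul_absolutelyContinuous

/-! ### Measurability of the matrix square root -/

section Sqrt

variable {ι : Type*} [Fintype ι]

theorem isClosed_setOf_posSemidef :
    IsClosed {X : ι → ι → ℝ | (Matrix.of X).PosSemidef} := by
  have : {X : ι → ι → ℝ | (Matrix.of X).PosSemidef}
      = {X | ∀ i j, X j i = X i j} ∩ {X | ∀ x : ι → ℝ, 0 ≤ ∑ i, x i * ∑ j, X i j * x j} := by
    ext X
    simp only [Set.mem_ofPred_eq, Set.mem_inter_iff, Matrix.posSemidef_iff_dotProduct_mulVec,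
      Matrix.IsHermitian.ext_iff, star_trivial, Matrix.of_apply, dotProduct, Matrix.mulVec]
  rw [this]
  refine IsClosed.inter ?_ ?_
  · simp only [Set.ofPred_forall]
    exact isClosed_iInter fun i => isClosed_iInter fun j =>
      isClosed_eq (by fun_prop) (by fun_prop)
  · simp only [Set.ofPred_forall]
    exact isClosed_iInter fun x => isClosed_le (by fun_prop) (by fun_prop)

theorem measurableSet_posSemidef {Ω : Type*} [MeasurableSpace Ω] {S : Ω → Matrix ι ι ℝ}
    (hS : ∀ i j, Measurable fun ω => S ω i j) : MeasurableSet {ω | (S ω).PosSemidef} :=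
  (measurable_pi_lambda (fun ω i j => S ω i j) fun i => measurable_pi_lambda _ fun j => hS i j)
    isClosed_setOf_posSemidef.measurableSet

theorem measurableSet_posDef [DecidableEq ι] {Ω : Type*} [MeasurableSpace Ω] {S : Ω → Matrix ι ι ℝ}
    (hS : ∀ i j, Measurable fun ω => S ω i j) : MeasurableSet {ω | (S ω).PosDef} := by
  have hdet : Measurable fun ω => (S ω).det := by
    simp only [Matrix.det_apply]
    fun_prop
  have : {ω | (S ω).PosDef} = {ω | (S ω).PosSemidef} ∩ {ω | (S ω).det ≠ 0} := by
    ext ω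
    exact ⟨fun h => ⟨h.posSemidef, h.det_pos.ne'⟩, fun h => h.1.posDef_iff_det_ne_zero.2 h.2⟩
  rw [this]
  exact (measurableSet_posSemidef hS).inter (hdet (measurableSet_singleton 0).compl)

/-- The matrix square root is measurable, being the inverse of the continuous injection `X ↦ X²`
on positive semidefinite matrices. -/
theorem measurable_sqrt_apply [DecidableEq ι] {Ω : Type*} [MeasurableSpace Ω] {S : Ω → Matrix ι ι ℝ}
    (hS : ∀ i j, Measurable fun ω => S ω i j) (i j : ι) :
    Measurable fun ω => CFC.sqrt (S ω) i j := by
  classical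
  let X := Subtype fun X : ι → ι → ℝ => (Matrix.of X).PosSemidef
  have : PolishSpace X := isClosed_setOf_posSemidef.polishSpace
  let f : X → ι → ι → ℝ := fun x i j => ∑ k, x.1 i k * x.1 k j
  have hf : Continuous f := by
    refine continuous_pi fun i => continuous_pi fun j => continuous_finsetSum _ fun k _ => ?_
    have h : ∀ a b, Continuous fun x : X => x.1 a b := fun a b =>
      (continuous_apply b).comp ((continuous_apply a).comp continuous_subtype_val)
    exact (h i k).mul (h k j)
  have hfx : ∀ x, Matrix.of (f x) = Matrix.of x.1 * Matrix.of x.1 := by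
    intro x
    ext i j
    simp [f, Matrix.mul_apply]
  have hinj : Function.Injective f := by
    intro x y hxy
    have h := congrArg Matrix.of hxy
    rw [hfx, hfx] at h
    have hx := CFC.sqrt_mul_self (Matrix.of x.1) x.2.nonneg
    have hy := CFC.sqrt_mul_self (Matrix.of y.1) y.2.nonneg
    rw [h, hy] at hx
    exact Subtype.ext (Matrix.of.injective hx.symm)
  have hemb := hf.measurableEmbedding hinj
  let g : Ω → X := fun ω => ⟨fun i j => CFC.sqrt (S ω) i j, posSemidef_sqrt (S ω)⟩
  -- Off the positive semidefinite matrices `CFC.sqrt` is zero, hence the indicator.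
  have hfg : f ∘ g = {ω | (S ω).PosSemidef}.indicator fun ω i j => S ω i j := by
    funext ω
    have hg : Matrix.of (f (g ω)) = CFC.sqrt (S ω) * CFC.sqrt (S ω) := hfx (g ω)
    by_cases h : (S ω).PosSemidef
    · rw [Set.indicator_of_mem (by exact h)]
      rw [CFC.sqrt_mul_sqrt_self _ h.nonneg] at hg
      exact hg
    · rw [Set.indicator_of_notMem (by exact h)]
      rw [CFC.sqrt_of_not_nonneg fun h' => h (Matrix.nonneg_iff_posSemidef.1 h'), mul_zero] at hg
      exact hg
  have hg : Measurable g := by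
    rw [← hemb.measurable_comp_iff, hfg]
    exact (measurable_pi_lambda _ fun i => measurable_pi_lambda _ fun j => hS i j).indicator
      (measurableSet_posSemidef hS)
  exact (measurable_pi_apply j).comp ((measurable_pi_apply i).comp (measurable_subtype_coe.comp hg))

end Sqrt

/-! ### Localization and local equality of constraint sets -/

section Localization

variable {ι : Type*} [Fintype ι]

/-- The closed condition on `ξ` which bounds `{δ ∈ S : δ' Q δ - 2 ξ' δ ≤ 0}` by `r`, up to a
null set of `ξ`. -/
def localizingSet (S : Set (EuclideanSpace ℝ ι)) (Q : Matrix ι ι ℝ) (r : ℝ) :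
    Set (EuclideanSpace ℝ ι) :=
  {ξ | ∀ δ ∈ S, r < ‖δ‖ → 0 ≤ δ.ofLp ⬝ᵥ (Q *ᵥ δ.ofLp) - 2 * (ξ.ofLp ⬝ᵥ δ.ofLp)}

theorem isClosed_localizingSet (S : Set (EuclideanSpace ℝ ι)) (Q : Matrix ι ι ℝ) (r : ℝ) :
    IsClosed (localizingSet S Q r) := by
  simp only [localizingSet, Set.ofPred_forall]
  refine isClosed_iInter fun δ => isClosed_iInter fun _ => isClosed_iInter fun _ =>
    isClosed_le (by fun_prop) ?_
  simp only [dotProduct]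
  fun_prop

theorem convex_localizingSet (S : Set (EuclideanSpace ℝ ι)) (Q : Matrix ι ι ℝ) (r : ℝ) :
    Convex ℝ (localizingSet S Q r) := by
  intro x hx y hy a b ha hb hab δ hδ hr
  have h1 := mul_nonneg ha (hx δ hδ hr)
  have h2 := mul_nonneg hb (hy δ hδ hr)
  simp only [WithLp.ofLp_add, WithLp.ofLp_smul, add_dotProduct, smul_dotProduct, smul_eq_mul]
  have : (a + b) * (δ.ofLp ⬝ᵥ (Q *ᵥ δ.ofLp)) = δ.ofLp ⬝ᵥ (Q *ᵥ δ.ofLp) := by rw [hab, one_mul]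
  nlinarith

theorem setOf_iSup_norm_le_eq (S : Set (EuclideanSpace ℝ ι)) (Q : Matrix ι ι ℝ) (r : ℝ) :
    {ξ | (⨆ δ ∈ basicSet S Q ξ, ((‖δ‖ : ℝ) : EReal)) ≤ (r : EReal)}
      = {ξ | ∀ δ ∈ S, r < ‖δ‖ → 0 < δ.ofLp ⬝ᵥ (Q *ᵥ δ.ofLp) - 2 * (ξ.ofLp ⬝ᵥ δ.ofLp)} := by
  ext ξ
  simp only [Set.mem_ofPred_eq, iSup_le_iff, basicSet, EReal.coe_le_coe_iff]
  refine forall_congr' fun δ => ⟨fun h hS hr => ?_, fun h hS => ?_⟩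
  · by_contra hc
    exact absurd (h ⟨hS, not_lt.1 hc⟩) (not_le.2 hr)
  · by_contra hc
    exact absurd (h hS.1 (not_le.1 hc)) (not_lt.2 hS.2)

/-- The event is given by strict inequalities and `localizingSet` by weak ones. The event therefore
lies between the interior of that convex set and the set itself, and the frontier is null. -/
theorem setOf_iSup_norm_le_ae_eq (S : Set (EuclideanSpace ℝ ι)) (Q : Matrix ι ι ℝ) {r : ℝ}
    (hr : 0 ≤ r) {μ : Measure (EuclideanSpace ℝ ι)} (hμ : μ ≪ volume) :
    {ξ | (⨆ δ ∈ basicSet S Q ξ, ((‖δ‖ : ℝ) : EReal)) ≤ (r : EReal)}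
      =ᵐ[μ] localizingSet S Q r := by
  rw [setOf_iSup_norm_le_eq]
  have hfr : μ (frontier (localizingSet S Q r)) = 0 :=
    hμ ((convex_localizingSet S Q r).addHaar_frontier volume)
  have hsub : {ξ : EuclideanSpace ℝ ι | ∀ δ ∈ S, r < ‖δ‖ →
      0 < δ.ofLp ⬝ᵥ (Q *ᵥ δ.ofLp) - 2 * (ξ.ofLp ⬝ᵥ δ.ofLp)} ⊆ localizingSet S Q r :=
    fun ξ h δ hδ hn => (h δ hδ hn).le
  have hint : interior (localizingSet S Q r) ⊆ {ξ : EuclideanSpace ℝ ι | ∀ δ ∈ S, r < ‖δ‖ →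
      0 < δ.ofLp ⬝ᵥ (Q *ᵥ δ.ofLp) - 2 * (ξ.ofLp ⬝ᵥ δ.ofLp)} := by
    -- Moving `ξ` slightly along `δ` strictly increases `ξ' δ`. Since the weak inequality survives
    -- this move, it was strict at `ξ`. Here `δ ≠ 0` because `‖δ‖ > r ≥ 0`.
    intro ξ hξ δ hδ hn
    have hcont : Continuous fun t : ℝ => ξ + t • δ := by fun_prop
    have hmem : (fun t : ℝ => ξ + t • δ) ⁻¹' localizingSet S Q r ∈ nhds (0 : ℝ) := by
      refine hcont.continuousAt.preimage_mem_nhds ?_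
      simpa using mem_interior_iff_mem_nhds.1 hξ
    obtain ⟨e, he, hball⟩ := Metric.mem_nhds_iff.1 hmem
    have ht : (e / 2) ∈ Metric.ball (0 : ℝ) e := by
      rw [Metric.mem_ball, Real.dist_eq, sub_zero, abs_of_pos (by positivity)]
      linarith
    have h := hball ht δ hδ hn
    simp only [WithLp.ofLp_add, WithLp.ofLp_smul, add_dotProduct, smul_dotProduct,
      smul_eq_mul] at h
    have hd : 0 < δ.ofLp ⬝ᵥ δ.ofLp := by
      have h0 : δ.ofLp ≠ 0 := by
        intro h0
        have : δ = 0 := by simpa using h0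
        rw [this, norm_zero] at hn
        linarith
      simpa using Matrix.dotProduct_star_self_pos_iff.2 h0
    nlinarith [mul_pos he hd]
  refine Filter.EventuallyLE.antisymm (Filter.Eventually.of_forall hsub) ?_
  refine ae_le_set.2 (measure_mono_null (fun ξ hξ => ?_) hfr)
  exact ⟨subset_closure hξ.1, fun h => hξ.2 (hint h)⟩

/-- Passing from a locally equal constraint set to a convex one does not increase the supremum of a
linear functional, as long as the localized set stays within the radius of local equality. -/
theorem iSup_basicSet_le_of_locallyEqual {S S' : Set (EuclideanSpace ℝ ι)} {Q : Matrix ι ι ℝ}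
    {r : ℝ} {ξ : EuclideanSpace ℝ ι} (hS : Convex ℝ S) (h0 : 0 ∈ S)
    (hQ : ∀ x : ι → ℝ, 0 ≤ x ⬝ᵥ (Q *ᵥ x)) (hloc : LocallyEqual S' S r)
    (hξ : (⨆ δ ∈ basicSet S Q ξ, ((‖δ‖ : ℝ) : EReal)) ≤ (r : EReal))
    (f : EuclideanSpace ℝ ι → ℝ) (hf : ∀ (t : ℝ) δ, f (t • δ) = t * f δ) {c : EReal}
    (hc : (⨆ δ ∈ basicSet S' Q ξ, ((f δ : ℝ) : EReal)) ≤ c) :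
    (⨆ δ ∈ basicSet S Q ξ, ((f δ : ℝ) : EReal)) ≤ c := by
  refine iSup₂_le fun δ hδ => ?_
  have hn : ‖δ‖ ≤ r := by
    have := (le_iSup₂ (f := fun δ (_ : δ ∈ basicSet S Q ξ) => ((‖δ‖ : ℝ) : EReal)) δ hδ).trans hξ
    exact_mod_cast this
  -- Shrinking by `t < 1` moves a point of norm at most `r` into the open ball. It preserves the
  -- quadratic inequality, since `t² δ'Qδ ≤ t δ'Qδ`. Letting `t → 1` recovers `δ`.
  have hscale : ∀ t ∈ Set.Ioo (0 : ℝ) 1, ((t * f δ : ℝ) : EReal) ≤ c := by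
    intro t ht
    have hmem : t • δ ∈ S := by
      have := hS hδ.1 h0 ht.1.le (by linarith [ht.2] : 0 ≤ 1 - t) (by ring)
      simpa using this
    have hball : t • δ ∈ Metric.ball (0 : EuclideanSpace ℝ ι) r := by
      rw [mem_ball_zero_iff, norm_smul, Real.norm_of_nonneg ht.1.le]
      have hr := hloc.1
      have := ht.1
      have := ht.2
      nlinarith [norm_nonneg δ]
    have hmem' : t • δ ∈ S' := by
      have h1 : t • δ ∈ S ∩ Metric.ball 0 r := ⟨hmem, hball⟩
      rw [← hloc.2] at h1
      exact h1.1
    have hb : t • δ ∈ basicSet S' Q ξ := by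
      refine ⟨hmem', ?_⟩
      have h2 := hδ.2
      have hq := hQ δ.ofLp
      simp only [WithLp.ofLp_smul, Matrix.mulVec_smul, smul_dotProduct, dotProduct_smul,
        smul_eq_mul]
      have h3 : t * (t * (δ.ofLp ⬝ᵥ (Q *ᵥ δ.ofLp))) ≤ t * (δ.ofLp ⬝ᵥ (Q *ᵥ δ.ofLp)) :=
        mul_le_mul_of_nonneg_left (by nlinarith [ht.2]) ht.1.le
      have h4 := mul_nonpos_of_nonneg_of_nonpos ht.1.le h2
      linarith
    rw [← hf]
    exact (le_iSup₂ (f := fun δ (_ : δ ∈ basicSet S' Q ξ) => ((f δ : ℝ) : EReal)) _ hb).trans hc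
  have htend : Filter.Tendsto (fun t : ℝ => ((t * f δ : ℝ) : EReal)) (nhdsWithin 1 (Set.Iio 1))
      (nhds ((f δ : ℝ) : EReal)) := by
    have h1 : Continuous fun t : ℝ => ((t * f δ : ℝ) : EReal) :=
      continuous_coe_real_ereal.comp (by fun_prop)
    have := h1.tendsto 1
    rw [one_mul] at this
    exact this.mono_left nhdsWithin_le_nhds
  refine le_of_tendsto htend ?_
  filter_upwards [Ioo_mem_nhdsLT (show (0 : ℝ) < 1 from one_pos)] with t ht
  exact hscale t ht

/-- Measurability in `ω` of the Gaussian probability of the localizing set, for the constraint set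
`{D (β - b(ω)) : β ∈ F}`. -/
theorem measurable_multivariateGaussian_localizingSet [DecidableEq ι] {Ω : Type*}
    [MeasurableSpace Ω] {S Q : Ω → Matrix ι ι ℝ} (hS : ∀ i j, Measurable fun ω => S ω i j)
    (hQ : ∀ i j, Measurable fun ω => Q ω i j) {b : Ω → ι → ℝ} (hb : Measurable b)
    (D : Matrix ι ι ℝ) (F : Set (ι → ℝ)) (r : ℝ) :
    Measurable fun ω => multivariateGaussian 0 (S ω)
      (localizingSet {h | ∃ β ∈ F, h = WithLp.toLp 2 (D *ᵥ (β - b ω))} (Q ω) r) := by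
  -- The dense subset is taken in the deterministic set `F`, so one countable family serves every
  -- `ω`. Written as a disjunction, the condition is closed in `β` and extends from `t` to `F`.
  obtain ⟨t, htF, htc, htd⟩ := (TopologicalSpace.IsSeparable.of_separableSpace
    F).exists_countable_dense_subset
  have hset : ∀ ω, localizingSet {h | ∃ β ∈ F, h = WithLp.toLp 2 (D *ᵥ (β - b ω))} (Q ω) r
      = ⋂ β ∈ t, {ξ | ‖(WithLp.toLp 2 (D *ᵥ (β - b ω)) : EuclideanSpace ℝ ι)‖ ≤ r ∨
        0 ≤ (D *ᵥ (β - b ω)) ⬝ᵥ (Q ω *ᵥ (D *ᵥ (β - b ω))) - 2 * (ξ.ofLp ⬝ᵥ (D *ᵥ (β - b ω)))} := by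
    intro ω
    ext ξ
    simp only [localizingSet, Set.mem_ofPred_eq, Set.mem_iInter]
    constructor
    · intro h β hβ
      by_cases hn : ‖(WithLp.toLp 2 (D *ᵥ (β - b ω)) : EuclideanSpace ℝ ι)‖ ≤ r
      · exact Or.inl hn
      · exact Or.inr (h _ ⟨β, htF hβ, rfl⟩ (not_le.1 hn))
    · rintro h _ ⟨β, hβ, rfl⟩ hn
      have hcl : IsClosed {β : ι → ℝ |
          ‖(WithLp.toLp 2 (D *ᵥ (β - b ω)) : EuclideanSpace ℝ ι)‖ ≤ r ∨
          0 ≤ (D *ᵥ (β - b ω)) ⬝ᵥ (Q ω *ᵥ (D *ᵥ (β - b ω)))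
            - 2 * (ξ.ofLp ⬝ᵥ (D *ᵥ (β - b ω)))} := by
        have hlin : Continuous fun β : ι → ℝ => D *ᵥ (β - b ω) := by fun_prop
        rw [Set.ofPred_or]
        refine IsClosed.union (isClosed_le ?_ continuous_const) (isClosed_le continuous_const ?_)
        · exact continuous_norm.comp ((PiLp.continuous_toLp 2 _).comp hlin)
        · exact (hlin.dotProduct (continuous_const.matrix_mulVec hlin)).sub
            (continuous_const.mul (continuous_const.dotProduct hlin))
      have := closure_minimal (fun β hβ => h β hβ) hcl (htd hβ)
      exact this.resolve_left (not_le.2 hn)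
  -- Pulling back to the standard Gaussian moves all dependence on `ω` from the measure into a
  -- section of a product set.
  have hlaw : ∀ ω, multivariateGaussian 0 (S ω)
      (localizingSet {h | ∃ β ∈ F, h = WithLp.toLp 2 (D *ᵥ (β - b ω))} (Q ω) r)
      = stdGaussian (EuclideanSpace ℝ ι) (Prod.mk ω ⁻¹' {q : Ω × EuclideanSpace ℝ ι | ∀ β ∈ t,
        ‖(WithLp.toLp 2 (D *ᵥ (β - b q.1)) : EuclideanSpace ℝ ι)‖ ≤ r ∨
        0 ≤ (D *ᵥ (β - b q.1)) ⬝ᵥ (Q q.1 *ᵥ (D *ᵥ (β - b q.1)))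
          - 2 * ((CFC.sqrt (S q.1) *ᵥ q.2.ofLp) ⬝ᵥ (D *ᵥ (β - b q.1)))}) := by
    intro ω
    rw [multivariateGaussian, Measure.map_apply (by fun_prop)
      (isClosed_localizingSet _ _ _).measurableSet, hset]
    congr 1
    ext x
    simp
  simp_rw [hlaw]
  refine measurable_measure_prodMk_left ?_
  simp only [Set.ofPred_forall]
  refine MeasurableSet.biInter htc fun β _ => ?_
  have hb' : ∀ i, Measurable fun ω => b ω i := fun i => (measurable_pi_apply i).comp hb
  have hDb : ∀ i, Measurable fun q : Ω × EuclideanSpace ℝ ι => (D *ᵥ (β - b q.1)) i := by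
    intro i
    simp only [Matrix.mulVec, dotProduct, Pi.sub_apply]
    exact Finset.measurable_sum _ fun j _ =>
      (measurable_const.sub ((hb' j).comp measurable_fst)).const_mul _
  have hQ' : ∀ i j, Measurable fun q : Ω × EuclideanSpace ℝ ι => Q q.1 i j :=
    fun i j => (hQ i j).comp measurable_fst
  have hR : ∀ i j, Measurable fun q : Ω × EuclideanSpace ℝ ι => CFC.sqrt (S q.1) i j :=
    fun i j => (measurable_sqrt_apply hS i j).comp measurable_fst
  have hx : ∀ i, Measurable fun q : Ω × EuclideanSpace ℝ ι => q.2.ofLp i := fun i => by fun_prop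
  have hn : Measurable fun q : Ω × EuclideanSpace ℝ ι =>
      ‖(WithLp.toLp 2 (D *ᵥ (β - b q.1)) : EuclideanSpace ℝ ι)‖ :=
    measurable_norm.comp ((WithLp.measurable_toLp 2 _).comp (measurable_pi_lambda _ hDb))
  rw [Set.ofPred_or]
  refine MeasurableSet.union (measurableSet_le hn measurable_const)
    (measurableSet_le measurable_const ?_)
  generalize hw : (fun q : Ω × EuclideanSpace ℝ ι => D *ᵥ (β - b q.1)) = w at hDb
  have hw' : ∀ q : Ω × EuclideanSpace ℝ ι, D *ᵥ (β - b q.1) = w q := fun q => congrFun hw q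
  simp only [hw'] at hDb ⊢
  simp only [Matrix.mulVec, dotProduct]
  fun_prop

end Localization

/-! ### Conditional probabilities and union bounds -/

section CondProb

variable {Ω : Type*} {m m₀ : MeasurableSpace Ω} {P : Measure Ω}

theorem condExp_indicator_one_of_not_nullMeasurableSet {S : Set Ω}
    (hS : ¬ NullMeasurableSet S P) : P⟦S | m⟧ = 0 := by
  refine condExp_of_not_integrable fun h => hS ?_
  exact (aemeasurable_indicator_const_iff (1 : ℝ)).1 h.aestronglyMeasurable.aemeasurable

/-- If the conditional probability of `S` is bounded below non-trivially on an event whose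
probability is bounded below non-trivially, then `S` is an event. -/
theorem nullMeasurableSet_of_le_measureReal_condExp {S : Set Ω} {a b : ℝ} (ha : 0 < a) (hb : 0 < b)
    (h : b ≤ P.real {ω | a ≤ (P⟦S | m⟧) ω}) : NullMeasurableSet S P := by
  by_contra hS
  rw [condExp_indicator_one_of_not_nullMeasurableSet hS] at h
  have : {ω : Ω | a ≤ (0 : Ω → ℝ) ω} = ∅ := by
    ext ω
    simpa using ha
  rw [this, measureReal_empty] at h
  linarith

theorem condExp_indicator_one_nonneg (S : Set Ω) : 0 ≤ᵐ[P] P⟦S | m⟧ :=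
  condExp_nonneg (Filter.Eventually.of_forall fun _ => Set.indicator_nonneg (by simp) _)

variable [IsProbabilityMeasure P]

theorem integrable_indicator_one_of_nullMeasurableSet {S : Set Ω} (hS : NullMeasurableSet S P) :
    Integrable (S.indicator fun _ => (1 : ℝ)) P :=
  (integrable_const (1 : ℝ)).indicator₀ hS

/-- By monotonicity the conditional probability of `S` is at most that of `V`, which is the
indicator of `V`. -/
theorem condExp_indicator_one_le_zero_of_subset (hm : m ≤ m₀) {S V : Set Ω}
    (hS : NullMeasurableSet S P) (hV : MeasurableSet[m] V) (hSV : S ⊆ V) :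
    ∀ᵐ ω ∂P, ω ∉ V → (P⟦S | m⟧) ω ≤ 0 := by
  have hVi : Integrable (V.indicator fun _ => (1 : ℝ)) P :=
    integrable_indicator_one_of_nullMeasurableSet (hm V hV).nullMeasurableSet
  have h := condExp_mono (m := m) (integrable_indicator_one_of_nullMeasurableSet hS) hVi
    (Filter.Eventually.of_forall fun ω =>
      Set.indicator_le_indicator_of_subset hSV (fun _ => zero_le_one) ω)
  rw [condExp_of_stronglyMeasurable hm
    ((stronglyMeasurable_const (b := (1 : ℝ))).indicator hV) hVi] at h
  filter_upwards [h] with ω hω hωV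
  rwa [Set.indicator_of_notMem hωV] at hω

/-- Bonferroni inequality for conditional probabilities, localized on an event of the conditioning
σ-field. -/
theorem condExp_indicator_one_add_add_le (hm : m ≤ m₀) {S₁ S₂ S₃ T E : Set Ω}
    (h₁ : NullMeasurableSet S₁ P) (h₂ : NullMeasurableSet S₂ P) (h₃ : NullMeasurableSet S₃ P)
    (hT : NullMeasurableSet T P) (hE : MeasurableSet[m] E)
    (h : ∀ᵐ ω ∂P, ω ∈ S₁ → ω ∈ S₂ → ω ∈ S₃ → ω ∈ E → ω ∈ T) :
    ∀ᵐ ω ∂P, ω ∈ E → (P⟦S₁ | m⟧) ω + (P⟦S₂ | m⟧) ω + (P⟦S₃ | m⟧) ω - 2 ≤ (P⟦T | m⟧) ω := by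
  have i₁ := integrable_indicator_one_of_nullMeasurableSet h₁
  have i₂ := integrable_indicator_one_of_nullMeasurableSet h₂
  have i₃ := integrable_indicator_one_of_nullMeasurableSet h₃
  have iT := integrable_indicator_one_of_nullMeasurableSet hT
  have i12 := i₁.add i₂
  have i123 := i12.add i₃
  have iall := i123.sub (integrable_const (2 : ℝ))
  have hmono := condExp_mono (m := m) (iall.indicator (hm E hE)) iT (by
    filter_upwards [h] with ω hω
    by_cases hωE : ω ∈ E
    · rw [Set.indicator_of_mem hωE]
      simp only [Pi.sub_apply, Pi.add_apply]
      by_cases a₁ : ω ∈ S₁ <;> by_cases a₂ : ω ∈ S₂ <;> by_cases a₃ : ω ∈ S₃ <;>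
        by_cases aT : ω ∈ T <;> simp [a₁, a₂, a₃, aT] <;> try norm_num
      exact aT (hω a₁ a₂ a₃ hωE)
    · rw [Set.indicator_of_notMem hωE]
      exact Set.indicator_nonneg (by simp) _)
  filter_upwards [hmono, condExp_indicator (m := m) iall hE,
    condExp_sub i123 (integrable_const (2 : ℝ)) m, condExp_add i12 i₃ m, condExp_add i₁ i₂ m]
    with ω e1 e2 e3 e4 e5 hωE
  rw [e2, Set.indicator_of_mem hωE, e3] at e1
  simp only [Pi.sub_apply, e4, Pi.add_apply, e5, condExp_const hm] at e1
  exact e1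

/-- Union bound over the complements of the `G`'s. Subadditivity alone handles `T`, which need not
be measurable. -/
theorem one_sub_le_measureReal_of_ae_imp {G₁ G₂ G₃ G₄ T : Set Ω} {a₁ a₂ a₃ a₄ : ℝ}
    (h₁ : NullMeasurableSet G₁ P) (h₂ : NullMeasurableSet G₂ P) (h₃ : NullMeasurableSet G₃ P)
    (h₄ : NullMeasurableSet G₄ P) (p₁ : 1 - a₁ ≤ P.real G₁) (p₂ : 1 - a₂ ≤ P.real G₂)
    (p₃ : 1 - a₃ ≤ P.real G₃) (p₄ : 1 - a₄ ≤ P.real G₄)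
    (h : ∀ᵐ ω ∂P, ω ∈ G₁ → ω ∈ G₂ → ω ∈ G₃ → ω ∈ G₄ → ω ∈ T) :
    1 - (a₁ + a₂ + a₃ + a₄) ≤ P.real T := by
  have hle : P.real Set.univ ≤ P.real (T ∪ G₁ᶜ ∪ G₂ᶜ ∪ G₃ᶜ ∪ G₄ᶜ) := by
    refine ENNReal.toReal_mono (measure_ne_top _ _) (measure_mono_ae ?_)
    filter_upwards [h] with ω hω _
    by_contra hc
    have hc' : ¬ ((((ω ∈ T ∨ ω ∉ G₁) ∨ ω ∉ G₂) ∨ ω ∉ G₃) ∨ ω ∉ G₄) := hc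
    tauto
  have u1 := measureReal_union_le (μ := P) (T ∪ G₁ᶜ ∪ G₂ᶜ ∪ G₃ᶜ) G₄ᶜ
  have u2 := measureReal_union_le (μ := P) (T ∪ G₁ᶜ ∪ G₂ᶜ) G₃ᶜ
  have u3 := measureReal_union_le (μ := P) (T ∪ G₁ᶜ) G₂ᶜ
  have u4 := measureReal_union_le (μ := P) T G₁ᶜ
  rw [probReal_univ] at hle
  have c₁ := probReal_compl_eq_one_sub₀ h₁
  have c₂ := probReal_compl_eq_one_sub₀ h₂
  have c₃ := probReal_compl_eq_one_sub₀ h₃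
  have c₄ := probReal_compl_eq_one_sub₀ h₄
  linarith

end CondProb

/-! ### Synthetic control model: measurability, convexity and quantile comparison -/

namespace SCModel

variable {Ω : Type*} {T₀ J K M : ℕ}

theorem H_le [MeasurableSpace Ω] {m : SCModel Ω T₀ J K M} (hB : Measurable m.B)
    (hC : Measurable m.C) (hx : Measurable m.x) (hg : Measurable m.g) :
    m.H ≤ ‹MeasurableSpace Ω› :=
  (hB.prodMk (hC.prodMk (hx.prodMk hg))).comap_le

theorem measurable_Z_apply (m : SCModel Ω T₀ J K M) (i : Fin T₀ × Fin M) (j : CoefIdx J K M) :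
    Measurable[m.H] fun ω => m.Z ω i j := by
  let := m.H
  have hinfo : Measurable m.info := comap_measurable m.info
  have hB : Measurable m.B := measurable_fst.comp hinfo
  have hC : Measurable m.C := measurable_fst.comp (measurable_snd.comp hinfo)
  rcases j with j | ⟨k, l⟩
  · simp only [Z, Matrix.fromCols_apply_inl, Bmat, Matrix.of_apply]
    fun_prop
  · simp only [Z, Matrix.fromCols_apply_inr, Cmat, Matrix.blockDiagonal_apply, Matrix.of_apply]
    split_ifs
    · fun_prop
    · exact measurable_const

theorem measurable_Qhat_apply (m : SCModel Ω T₀ J K M) (i j : CoefIdx J K M) :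
    Measurable[m.H] fun ω => m.Qhat ω i j := by
  let := m.H
  have := m.measurable_Z_apply
  simp only [Qhat, Matrix.mul_apply, Matrix.transpose_apply]
  fun_prop

theorem measurable_Sigma_apply [MeasurableSpace Ω] (m : SCModel Ω T₀ J K M) (P : Measure Ω)
    [IsFiniteMeasure P] (i j : CoefIdx J K M) : Measurable[m.H] fun ω => m.Sigma P ω i j := by
  have hmean : ∀ i : CoefIdx J K M, Measurable fun z =>
      ∫ y : CoefIdx J K M → ℝ, y i ∂(condDistrib m.gammaHat m.info P z) := fun i =>
    (StronglyMeasurable.integral_kernel (f := fun y : CoefIdx J K M → ℝ => y i)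
      (measurable_pi_apply i).stronglyMeasurable).measurable
  have hcov : Measurable fun z => covariance (fun y : CoefIdx J K M → ℝ => y i) (fun y => y j)
      (condDistrib m.gammaHat m.info P z) := by
    simp only [covariance]
    refine (StronglyMeasurable.integral_kernel_prod_right (f := fun z (y : CoefIdx J K M → ℝ) =>
      (y i - ∫ y : CoefIdx J K M → ℝ, y i ∂(condDistrib m.gammaHat m.info P z))
      * (y j - ∫ y : CoefIdx J K M → ℝ, y j ∂(condDistrib m.gammaHat m.info P z)))
      (Measurable.stronglyMeasurable ?_)).measurable
    exact (((measurable_pi_apply i).comp measurable_snd).sub ((hmean i).comp measurable_fst)).mul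
      (((measurable_pi_apply j).comp measurable_snd).sub ((hmean j).comp measurable_fst))
  exact hcov.comp (comap_measurable m.info)

theorem Qhat_quadratic_nonneg (m : SCModel Ω T₀ J K M) (ω : Ω) (x : CoefIdx J K M → ℝ) :
    0 ≤ x ⬝ᵥ (m.Qhat ω *ᵥ x) := by
  have hD : ((m.D)⁻¹)ᵀ = (m.D)⁻¹ := by
    rw [Matrix.transpose_nonsing_inv, D, Matrix.diagonal_transpose]
  have : m.Qhat ω = (m.Z ω * (m.D)⁻¹)ᵀ * (m.Z ω * (m.D)⁻¹) := by
    rw [Matrix.transpose_mul, hD, Qhat]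
    simp only [Matrix.mul_assoc]
  rw [this, ← Matrix.mulVec_mulVec, Matrix.dotProduct_mulVec, Matrix.vecMul_transpose]
  exact Finset.sum_nonneg fun i _ => mul_self_nonneg _

theorem convex_feasible {m : SCModel Ω T₀ J K M} (hW : Convex ℝ m.W) (hR : Convex ℝ m.R) :
    Convex ℝ m.feasible := fun _ hx _ hy _ _ ha hb hab =>
  ⟨hW hx.1 hy.1 ha hb hab, hR hx.2 hy.2 ha hb hab⟩

theorem convex_Delta {m : SCModel Ω T₀ J K M} (hW : Convex ℝ m.W) (hR : Convex ℝ m.R) (ω : Ω) :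
    Convex ℝ (m.Delta ω) := by
  rintro _ ⟨x, hx, rfl⟩ _ ⟨y, hy, rfl⟩ a b ha hb hab
  refine ⟨a • x + b • y, convex_feasible hW hR hx hy ha hb hab, ?_⟩
  rw [← WithLp.toLp_smul, ← WithLp.toLp_smul, ← WithLp.toLp_add, ← Matrix.mulVec_smul,
    ← Matrix.mulVec_smul, ← Matrix.mulVec_add]
  congr 2
  have : m.β₀ ω = a • m.β₀ ω + b • m.β₀ ω := by rw [← add_smul, hab, one_smul]
  conv_rhs => rw [this]
  simp only [smul_sub]
  abel

theorem zero_mem_Delta {m : SCModel Ω T₀ J K M} {ω : Ω} (h : m.β₀ ω ∈ m.feasible) :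
    0 ∈ m.Delta ω :=
  ⟨m.β₀ ω, h, by simp⟩

theorem target_smul (m : SCModel Ω T₀ J K M) (ω : Ω) (t : ℝ) (δ : CoefSpace J K M) :
    m.target ω (t • δ) = t * m.target ω δ := by
  simp only [target, WithLp.ofLp_smul, Matrix.mulVec_smul, dotProduct_smul, smul_eq_mul]

theorem measurable_target_deltaHat [MeasurableSpace Ω] {m : SCModel Ω T₀ J K M}
    (hx : Measurable m.x) (hg : Measurable m.g) (hβ : Measurable m.βhat) (hβ₀ : Measurable m.β₀) :
    Measurable fun ω => m.target ω (m.deltaHat ω) := by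
  have hp : ∀ i, Measurable fun ω => m.p ω i := by
    rintro (i | i)
    · exact (measurable_pi_apply i).comp hx
    · exact (measurable_pi_apply i).comp hg
  simp only [target, deltaHat, Matrix.mulVec, dotProduct, Pi.sub_apply]
  fun_prop

/-- The quantile for the law `N(0, Σ)` and the set `Δ` is at most the simulated quantile, once the
level is lowered by the Gaussian approximation error and the probability of leaving the region where
the constraint sets agree. -/
theorem cDagger_le_cStar [MeasurableSpace Ω] {m : SCModel Ω T₀ J K M} {P : Measure Ω}
    [IsFiniteMeasure P] (hW : Convex ℝ m.W) (hR : Convex ℝ m.R) {ω : Ω}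
    (hβ₀ : m.β₀ ω ∈ m.feasible) (hSig : (m.Sigma P ω).PosDef) (hSigHat : (m.SigmaHat ω).PosSemidef)
    {r ε e : ℝ} (hε : 0 ≤ ε) (hε' : ε ≤ 1 / 4)
    (hfrob : frobNorm (invSqrt (m.Sigma P ω) * m.SigmaHat ω * invSqrt (m.Sigma P ω) - 1) ≤ 2 * ε)
    (hloc : LocallyEqual (m.DeltaStar ω) (m.Delta ω) r)
    (hbdd : 1 - e ≤ (m.lawG P ω).real (localizingSet (m.Delta ω) (m.Qhat ω) r)) (q : ℝ) :
    m.cDagger P (q - (e + ε)) ω ≤ m.cStar q ω := by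
  have hac : m.lawG P ω ≪ volume := multivariateGaussian_absolutelyContinuous hSig
  have hprob : IsProbabilityMeasure (m.lawG P ω) := by
    rw [lawG]
    infer_instance
  have hae := setOf_iSup_norm_le_ae_eq (m.Delta ω) (m.Qhat ω) hloc.1.le hac
  set B := {ξ : CoefSpace J K M |
    (⨆ δ ∈ basicSet (m.Delta ω) (m.Qhat ω) ξ, ((‖δ‖ : ℝ) : EReal)) ≤ (r : EReal)} with hB
  have hBm : NullMeasurableSet B (m.lawG P ω) :=
    (isClosed_localizingSet _ _ _).measurableSet.nullMeasurableSet.congr hae.symm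
  rw [← measureReal_congr hae] at hbdd
  -- Every `c` admissible for the simulated quantile is admissible for the other at the lowered
  -- level. This compares the infima without requiring the suprema to be measurable in `ξ`.
  refine sInf_le_sInf fun c hc => ?_
  simp only [Set.mem_ofPred_eq] at hc ⊢
  have h1 := multivariateGaussian_le_add hSig hSigHat hε hε' hfrob
    {y | m.supTarget ω (m.DeltaStar ω) y ≤ c}
  have h2 : (m.lawG P ω).real {y | m.supTarget ω (m.DeltaStar ω) y ≤ c}
      ≤ (m.lawG P ω).real ({y | m.supTarget ω (m.Delta ω) y ≤ c} ∪ Bᶜ) := by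
    refine measureReal_mono fun y hy => ?_
    by_cases hyB : y ∈ B
    · exact Or.inl (iSup_basicSet_le_of_locallyEqual (convex_Delta hW hR ω) (zero_mem_Delta hβ₀)
        (m.Qhat_quadratic_nonneg ω) hloc hyB _ (m.target_smul ω) hy)
    · exact Or.inr hyB
  have h3 := measureReal_union_le (μ := m.lawG P ω) {y | m.supTarget ω (m.Delta ω) y ≤ c} Bᶜ
  rw [probReal_compl_eq_one_sub₀ hBm] at h3
  change q ≤ (multivariateGaussian 0 (m.SigmaHat ω)).real _ at hc
  change _ ≤ (m.lawG P ω).real _ + ε at h1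
  linarith

end SCModel

/-! ### The plug-in approximation theorem -/

theorem theorem2 {Ω : Type*} [MeasurableSpace Ω] (P : Measure Ω) [IsProbabilityMeasure P]
    {T₀ J K M : ℕ} (m : SCModel Ω T₀ J K M)
    -- the data are random vectors, the scaling matrix is invertible, the variance estimate is a
    -- covariance matrix
    (hA : Measurable m.A) (hB : Measurable m.B) (hC : Measurable m.C)
    (hx : Measurable m.x) (hg : Measurable m.g)
    (hD : ∀ i, 0 < m.scale i)
    (hSigmaHat : ∀ ω, (m.SigmaHat ω).PosSemidef)
    (hW : Convex ℝ m.W) (hR : Convex ℝ m.R)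
    (hβhat : m.IsEstimator P) (hβ₀ : m.IsPseudoTrue P)
    (εγ πγ ϖδ εδ πδ εΔ πΔ εγ1 εγ2 πγs : ℝ)
    (hεγ : 0 ≤ εγ) (hπγ : 0 ≤ πγ) (hϖδ : 0 ≤ ϖδ) (hεδ : 0 ≤ εδ) (hπδ : 0 ≤ πδ)
    (hεΔ : 0 ≤ εΔ) (hπΔ : 0 ≤ πΔ) (hεγ1 : 0 ≤ εγ1) (hεγ2 : 0 ≤ εγ2) (hπγs : 0 ≤ πγs)
    -- (i) infeasible coverage, at every level
    (hi : ∀ a ∈ Set.Ioo (0 : ℝ) 1,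
      1 - πγ ≤ P.real {ω | 1 - a - εγ ≤
        (P⟦{ω' | ((m.target ω' (m.deltaHat ω') : ℝ) : EReal) ≤ m.cDagger P (1 - a) ω'} | m.H⟧) ω})
    -- (ii) the Gaussian localized set is bounded
    (hii : 1 - πδ ≤ P.real {ω | 1 - εδ ≤ (m.lawG P ω).real
      {ξ | (⨆ δ ∈ basicSet (m.Delta ω) (m.Qhat ω) ξ, ((‖δ‖ : ℝ) : EReal)) ≤ (ϖδ : EReal)}})
    -- (iii) the simulation constraint set is locally equal to `Δ`
    (hiii : 1 - πΔ ≤ P.real {ω | 1 - εΔ ≤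
      (P⟦{ω' | LocallyEqual (m.DeltaStar ω') (m.Delta ω') ϖδ} | m.H⟧) ω})
    -- (iv) the variance estimate is close to `Σ`
    (hiv : 1 - πγs ≤ P.real {ω | 1 - εγ2 ≤
      (P⟦{ω' | frobNorm (invSqrt (m.Sigma P ω') * m.SigmaHat ω' * invSqrt (m.Sigma P ω') - 1)
        ≤ 2 * εγ1} | m.H⟧) ω})
    (hεγ1' : εγ1 ≤ 1 / 4)
    (α : ℝ) (hα : α ∈ Set.Ioo (0 : ℝ) 1)
    -- the simulated quantile is a random variable
    (hcStar : AEMeasurable (m.cStar (1 - α)) P) :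
    1 - (πγ + πγs + πδ + πΔ) ≤
      P.real {ω | 1 - α - (εγ + εγ1 + εγ2 + εδ + εΔ) ≤
        (P⟦{ω' | ((m.target ω' (m.deltaHat ω') : ℝ) : EReal) ≤ m.cStar (1 - α) ω'} | m.H⟧) ω} := by
  have hH := SCModel.H_le hB hC hx hg
  by_cases hπ : 1 - (πγ + πγs + πδ + πΔ) ≤ 0
  · exact hπ.trans measureReal_nonneg
  -- If the target level is nonpositive, nonnegativity of conditional probabilities suffices.
  -- Otherwise `α + εδ + εγ1 < 1`, so (i) applies at that level and the bounds in (i), (iii), (iv)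
  -- are nontrivial.
  by_cases hε : 1 - α - (εγ + εγ1 + εγ2 + εδ + εΔ) ≤ 0
  · refine le_of_le_of_eq (b := 1) (by linarith) ((probReal_univ (μ := P)).symm.trans
      (measureReal_congr (Filter.eventuallyEq_univ.2 ?_)).symm)
    filter_upwards [condExp_indicator_one_nonneg (P := P) (m := m.H)
      {ω' | ((m.target ω' (m.deltaHat ω') : ℝ) : EReal) ≤ m.cStar (1 - α) ω'}] with ω hω
    exact hε.trans hω
  rw [not_le] at hπ hε
  have hα0 := hα.1
  have hlevel : α + (εδ + εγ1) ∈ Set.Ioo (0 : ℝ) 1 := ⟨by linarith, by linarith⟩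
  have hi' := hi _ hlevel
  have hS₁ := nullMeasurableSet_of_le_measureReal_condExp (by linarith) (by linarith) hi'
  have hS₃ := nullMeasurableSet_of_le_measureReal_condExp (by linarith) (by linarith) hiii
  have hS₄ := nullMeasurableSet_of_le_measureReal_condExp (by linarith) (by linarith) hiv
  have hT : NullMeasurableSet
      {ω' | ((m.target ω' (m.deltaHat ω') : ℝ) : EReal) ≤ m.cStar (1 - α) ω'} P :=
    nullMeasurableSet_le (measurable_coe_real_ereal.comp (SCModel.measurable_target_deltaHat hx hg
      hβhat.1 (hβ₀.1.mono hH le_rfl))).aemeasurable hcStar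
  have hV : MeasurableSet[m.H] {ω | (m.Sigma P ω).PosDef} :=
    @measurableSet_posDef _ _ _ _ m.H _ (m.measurable_Sigma_apply P)
  have hloc : MeasurableSet[m.H]
      {ω | 1 - εδ ≤ (m.lawG P ω).real (localizingSet (m.Delta ω) (m.Qhat ω) ϖδ)} := by
    have := @measurable_multivariateGaussian_localizingSet _ _ _ _ m.H _ _
      (m.measurable_Sigma_apply P) m.measurable_Qhat_apply _ hβ₀.1 m.D m.feasible ϖδ
    exact @measurableSet_le _ _ _ _ _ m.H _ _ _ _ _ (@measurable_const _ _ _ m.H _)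
      (@Measurable.ennreal_toReal _ m.H _ this)
  -- The localization event belongs to `ℋ`, so it restricts `ω` without using up a Bonferroni term;
  -- `εδ` enters only through the shifted level.
  have hcond := condExp_indicator_one_add_add_le (P := P) hH hS₁ hS₃ hS₄ hT
    (@MeasurableSet.inter _ m.H _ _ hV hloc) (by
      filter_upwards [hβ₀.2] with ω hω h₁ h₃ h₄ hE
      refine le_trans h₁ ?_
      have := SCModel.cDagger_le_cStar hW hR hω.1 hE.1 (hSigmaHat ω) hεγ1 hεγ1' h₄ h₃ hE.2 (1 - α)
      rwa [show 1 - (α + (εδ + εγ1)) = 1 - α - (εδ + εγ1) by ring])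
  have hpos := condExp_indicator_one_le_zero_of_subset (P := P) hH hS₄ hV
    fun ω hω => posDef_of_frobNorm_invSqrt_le (le_trans hω (by linarith))
  -- The event in (ii) is enlarged to an `ℋ`-measurable one. Where `Σ` is not positive definite the
  -- almost-everywhere identification is unavailable, so those `ω` are included here and excluded
  -- later by (iv).
  have hii' : 1 - πδ ≤ P.real ({ω | (m.Sigma P ω).PosDef}ᶜ ∪
      {ω | 1 - εδ ≤ (m.lawG P ω).real (localizingSet (m.Delta ω) (m.Qhat ω) ϖδ)}) := by
    refine hii.trans (measureReal_mono fun ω hω => ?_)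
    by_cases hωV : (m.Sigma P ω).PosDef
    · refine Or.inr ?_
      have := measureReal_congr (setOf_iSup_norm_le_ae_eq (m.Delta ω) (m.Qhat ω) hϖδ
        (μ := m.lawG P ω) (multivariateGaussian_absolutelyContinuous hωV))
      simp only [Set.mem_ofPred_eq] at hω ⊢
      rwa [← this]
    · exact Or.inl hωV
  have hmeas : ∀ (S : Set Ω) (c : ℝ), NullMeasurableSet {ω | c ≤ (P⟦S | m.H⟧) ω} P := fun S c =>
    (measurableSet_le measurable_const
      (stronglyMeasurable_condExp.measurable.mono hH le_rfl)).nullMeasurableSet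
  refine one_sub_le_measureReal_of_ae_imp (hmeas _ _) (hmeas _ _)
    ((hH _ hV).compl.union (hH _ hloc)).nullMeasurableSet (hmeas _ _) hi' hiv hii' hiii ?_
  filter_upwards [hcond, hpos] with ω hω hωV h₁ h₄ h₂ h₃
  have hmem : (m.Sigma P ω).PosDef := by
    -- Off positive definiteness the conditional probability in (iv) is at most zero, contradicting
    -- `1 - εγ2 > 0`.
    by_contra hn
    have := hωV hn
    linarith
  have := hω ⟨hmem, h₂.resolve_left fun h => h hmem⟩
  linarith
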